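/- **Model.** Let $G$ be a finite connected simple undirected graph with vertex set $V$, $|V|\ge 2$, and Laplacian $L=D-A$; let $\lambda>0$ be the gap between the zero and the non-zero eigenvalues of $L$, i.e. its least non-zero eigenvalue. Let $\mathcal H=\mathrm{span}\{|v\rangle:v\in V\}$, $|\pi\rangle=|V|^{-1/2}\sum_{v\in V}|v\rangle$, and let $\mathcal K=(\mathbb C^2)^{\otimes a}$ be an ancillary register of $a$ qubits. A *controlled intermittent quantum walk* (CIQW) with one control qubit is an operator on $\mathcal K\otimes\mathcal H$ of the form $$W=(U_m\otimes I)\,\Lambda(e^{iLt_m})\cdots(U_1\otimes I)\,\Lambda(e^{iLt_1})\,(U_0\otimes I),$$ where $U_0,\dots,U_m$ are unitaries of $\mathcal K$, $t_1,\dots,t_m\in\mathbb R$, and $\Lambda(e^{iLt})=|0\rangle\langle0|\otimes I+|1\rangle\langle1|\otimes e^{iLt}$ is controlled by a fixed qubit of $\mathcal K$; its evolution time is $\sum_{j=1}^m|t_j|$. For a set $M\subseteq V$ of marked vertices with indicator function $f$, an oracle query is one use of the phase oracle $|x\rangle|v\rangle\mapsto(-1)^{f(v)}|x\rangle|v\rangle$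 or of the standard oracle $|b\rangle|v\rangle\mapsto|b\oplus f(v)\rangle|v\rangle$ with $b$ a qubit of $\mathcal K$. A *CIQW-based algorithm* starts in $|0^a\rangle|\pi\rangle$, applies finitely many CIQWs, oracle queries and measurements of ancillary qubits in the computational basis (later operations may depend on earlier outcomes), and finally measures $\mathcal H$ in the vertex basis and outputs the vertex found. Its query complexity and its total evolution time are the maxima, over the measurement outcomes, of the number of oracle queries and of the sum of the evolution times of the CIQWs applied. **Theorem.** There are universal constants $c,C>0$ such that for every finite connected simple undirected graph $G$ with at least two vertices and Laplacian gap $\lambda$, and every $\varepsilon\in(0,1]$, there is a CIQW-based algorithm, not depending on the set of marked vertices, which makes at most $C/\sqrt\varepsilon$ oracle queries, uses total evolution time at most $C/(\lambda\sqrt\varepsilon)$ of the controlled walk $e^{iLt}$, and, for every set $M\subseteq V$ of marked vertices with $|M|\ge\varepsilon|V|$, outputs a marked vertex with probability at least $c$. -/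

import Mathlib

open scoped Kronecker

noncomputable section

namespace SpatialSearch

/-- The computational basis of an ancillary register of `a` qubits. -/
abbrev Qubits (a : ℕ) : Type := Fin a → Bool

/-- State vectors of the joint system (ancillary register) ⊗ (walking space spanned by the
vertices), in the basis `|x⟩|v⟩`. A vector need not be normalised: after a measurement the
unnormalised branch is kept, its squared norm being the probability of the branch. -/
abbrev State (a : ℕ) (V : Type*) : Type _ := Qubits a × V → ℂ

section Walk

variable {V : Type*} [Fintype V] [DecidableEq V]

/-- `lam` is the gap between the zero and the non-zero eigenvalues of the Laplacian `D - A`,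
that is, the least non-zero eigenvalue. -/
def IsLaplacianGap (G : SimpleGraph V) [DecidableRel G.Adj] (lam : ℝ) : Prop :=
  IsLeast {μ : ℝ | μ ≠ 0 ∧ Module.End.HasEigenvalue (Matrix.toLin' (G.lapMatrix ℝ)) μ} lam

/-- The continuous-time quantum walk `e^{iLt}`, where `L` is the Laplacian of `G`. -/
def ctqw (G : SimpleGraph V) [DecidableRel G.Adj] (t : ℝ) : Matrix V V ℂ :=
  NormedSpace.exp ((Complex.I * (t : ℂ)) • G.lapMatrix ℂ)

/-- The controlled walk `|0⟩⟨0| ⊗ I + |1⟩⟨1| ⊗ e^{iLt}`, controlled by the ancillary qubit `j`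
(and acting as the identity on the other ancillary qubits). -/
def controlledWalk (G : SimpleGraph V) [DecidableRel G.Adj] {a : ℕ} (j : Fin a) (t : ℝ) :
    Matrix (Qubits a × V) (Qubits a × V) ℂ :=
  Matrix.diagonal (fun x : Qubits a => if x j then (0 : ℂ) else 1) ⊗ₖ (1 : Matrix V V ℂ) +
    Matrix.diagonal (fun x : Qubits a => if x j then (1 : ℂ) else 0) ⊗ₖ ctqw G t

end Walk

/-- A controlled intermittent quantum walk with one control qubit: unitaries
`U₀, U₁, …, U_m` of the ancillary register, interleaved with controlled walks for the times
`t₁, …, t_m`. A negative time stands for the inverse walk. -/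
structure CIQW (a : ℕ) where
  control : Fin a
  first : Matrix.unitaryGroup (Qubits a) ℂ
  steps : List (ℝ × Matrix.unitaryGroup (Qubits a) ℂ)

/-- The total evolution time `∑ⱼ |tⱼ|`. -/
def CIQW.time {a : ℕ} (W : CIQW a) : ℝ := (W.steps.map fun s => |s.1|).sum

/-- The operator
`(U_m ⊗ I) Λ(e^{iLt_m}) ⋯ (U₁ ⊗ I) Λ(e^{iLt₁}) (U₀ ⊗ I)`. -/
def CIQW.op {V : Type*} [Fintype V] [DecidableEq V] (G : SimpleGraph V) [DecidableRel G.Adj]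
    {a : ℕ} (W : CIQW a) : Matrix (Qubits a × V) (Qubits a × V) ℂ :=
  W.steps.foldl
    (fun B s => ((s.2 : Matrix (Qubits a) (Qubits a) ℂ) ⊗ₖ (1 : Matrix V V ℂ)) *
      (controlledWalk G W.control s.1 * B))
    ((W.first : Matrix (Qubits a) (Qubits a) ℂ) ⊗ₖ (1 : Matrix V V ℂ))

section Operations

variable {V : Type*} [DecidableEq V] {a : ℕ}

/-- The phase oracle `|x⟩|v⟩ ↦ (-1)^{[v ∈ M]} |x⟩|v⟩`. -/
def applyPhaseOracle (M : Finset V) (ψ : State a V) : State a V :=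
  fun p => if p.2 ∈ M then -ψ p else ψ p

/-- The standard oracle `|b⟩|v⟩ ↦ |b ⊕ [v ∈ M]⟩|v⟩`, with `b` the ancillary qubit `j`. -/
def applyOracle (M : Finset V) (j : Fin a) (ψ : State a V) : State a V :=
  fun p => ψ (if p.2 ∈ M then Function.update p.1 j (!p.1 j) else p.1, p.2)

/-- The projection onto the subspace where the ancillary qubit `j` has the value `b`. -/
def projectQubit {V : Type*} (j : Fin a) (b : Bool) (ψ : State a V) : State a V :=
  fun p => if p.1 j = b then ψ p else 0

/-- The initial state `|0…0⟩|π⟩`, where `|π⟩` is the uniform superposition of the vertices. -/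
def initialState (a : ℕ) (V : Type*) [Fintype V] : State a V :=
  fun p => if p.1 = (fun _ => false) then ((Real.sqrt (Fintype.card V) : ℝ) : ℂ)⁻¹ else 0

end Operations

/-- Algorithms based on controlled intermittent quantum walks, with `a` ancillary qubits.
The walking space is touched only by the walks, by the oracles and by the final measurement.
* `output` measures the walking space in the vertex basis, outputs the result, and stops;
* `walk W p` applies the walk `W`, then runs `p`;
* `phaseOracle p` and `oracle j p` make one oracle query, then run `p`;
* `measure j p₀ p₁` measures the ancillary qubit `j`, then runs `p₀` or `p₁` according to
  the result. -/
inductive Algorithm (a : ℕ) : Type where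
  | output : Algorithm a
  | walk (W : CIQW a) (p : Algorithm a) : Algorithm a
  | phaseOracle (p : Algorithm a) : Algorithm a
  | oracle (j : Fin a) (p : Algorithm a) : Algorithm a
  | measure (j : Fin a) (p₀ p₁ : Algorithm a) : Algorithm a

namespace Algorithm

variable {a : ℕ}

/-- The number of oracle queries (of either kind) in the worst case over the outcomes of the
measurements. -/
def queries : Algorithm a → ℕ
  | output => 0
  | walk _ p => p.queries
  | phaseOracle p => p.queries + 1
  | oracle _ p => p.queries + 1
  | measure _ p₀ p₁ => max p₀.queries p₁.queries

/-- The total evolution time of the controlled walks in the worst case over the outcomes of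
the measurements. -/
def time : Algorithm a → ℝ
  | output => 0
  | walk W p => W.time + p.time
  | phaseOracle p => p.time
  | oracle _ p => p.time
  | measure _ p₀ p₁ => max p₀.time p₁.time

/-- The probability that the algorithm, run from the state `ψ` on the graph `G` with the set
`M` of marked vertices, outputs the vertex `v`. -/
def outputProb {V : Type*} [Fintype V] [DecidableEq V] (G : SimpleGraph V)
    [DecidableRel G.Adj] (M : Finset V) (v : V) : Algorithm a → State a V → ℝ
  | output, ψ => ∑ x : Qubits a, ‖ψ (x, v)‖ ^ 2
  | walk W p, ψ => outputProb G M v p ((W.op G).mulVec ψ)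
  | phaseOracle p, ψ => outputProb G M v p (applyPhaseOracle M ψ)
  | oracle j p, ψ => outputProb G M v p (applyOracle M j ψ)
  | measure j p₀ p₁, ψ =>
      outputProb G M v p₀ (projectQubit j false ψ) + outputProb G M v p₁ (projectQubit j true ψ)

/-- The probability that the algorithm, run from `|0…0⟩|π⟩`, outputs a marked vertex. -/
def successProb {V : Type*} [Fintype V] [DecidableEq V] (G : SimpleGraph V)
    [DecidableRel G.Adj] (M : Finset V) (A : Algorithm a) : ℝ :=
  ∑ v ∈ M, outputProb G M v A (initialState a V)

end Algorithm

end SpatialSearch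

end

/-! Let `P` project onto the marked vertices, let `Ω` be the uniform state `κ ⊗ π` and `σ = ‖PΩ‖ =
√(|M|/|V|)`. The search is recursive amplitude amplification: `A_{i+1} = A_i R_i A_i⁻¹ S A_i` with
`S = 1 - 2P` and `R_i` an approximate reflection through `Ω`. With exact reflections the marked
amplitude `s` becomes `(3 - 4s²)s`, so it roughly triples per level, and so does the number of
queries.

The reflection is `R = Λ⁻¹(2|κ⟩⟨κ| - 1)Λ`, where `Λ` applies walks for the times `t, 2t, …,
2^(k-1)t`, each controlled by its own qubit. Compressed to `κ`, `Λ` becomes `∏ (1 + e^{iLt2^j})/2`,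
a geometric average of walks that fixes `π` and has norm at most `π/(tλ2^k)` on its complement
(`norm_averagedWalk_sub_le`). This compression is valid on every state independent of the control
qubits, hence each level owns fresh qubits (`norm_reflectionCircuit_sub_le`).

No logarithm is lost because level `i` is allowed an error of order `2⁻ⁱ`: the errors are summable,
so amplitudes stay of order `3^i σ`, while a reflection costs time of order `2^i/λ`, which the
factor `3^i` dominates (`circuitTime_searchCircuit_le`, `IsSchedule.amplitude_bounds`).

Since `|M|` is unknown, the levels `0, 5, 10, …` are tried in turn, with a test for markedness after
each. The initial state cannot be prepared anew, so a failed test hands its leftover state to the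
next level. That state is within `O(3^i σ)` of `Ω`, and the sum of these deviations over the earlier
tries is small against the amplitude at the level where `3^i σ` reaches constant order
(`sq_le_successFrom_attempts`, `IsSchedule.le_successFrom`). -/

noncomputable section

namespace SpatialSearch

/-! ### One amplification step with an imperfect reflection. -/

section Amplification

variable {E : Type*} [NormedAddCommGroup E] [InnerProductSpace ℂ E]

/-- One level of recursive amplitude amplification with an approximate reflection `R`. -/
theorem exists_amplification_step (U R S : E ≃ₗᵢ[ℂ] E) (P : E →ₗ[ℂ] E) (Ω : E) (β : ℝ)
    (hP : ∀ x, inner ℂ x (P x) = (‖P x‖ : ℂ) ^ 2)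
    (hS : ∀ x, S x = x - (2 : ℂ) • P x) (hRΩ : R Ω = Ω)
    (hR : ‖R (U.symm (P (U Ω))) - ((2 * inner ℂ Ω (U.symm (P (U Ω)))) • Ω
      - U.symm (P (U Ω)))‖ ≤ 2 * β * ‖U.symm (P (U Ω))‖) :
    ∃ e : E, ‖e‖ ≤ 4 * β * ‖P (U Ω)‖ ∧
      U (R (U.symm (S (U Ω)))) =
        ((1 - 4 * ‖P (U Ω)‖ ^ 2 : ℝ) : ℂ) • U Ω + (2 : ℂ) • P (U Ω) + e := by
  set ξ := U.symm (P (U Ω)) with hξ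
  have hξn : ‖ξ‖ = ‖P (U Ω)‖ := by rw [hξ]; exact U.symm.norm_map _
  have hUξ : U ξ = P (U Ω) := by rw [hξ]; exact U.apply_symm_apply _
  have hin : inner ℂ Ω ξ = (‖P (U Ω)‖ : ℂ) ^ 2 := by
    rw [← hP, ← hUξ, U.inner_map_map]
  set e := R ξ - ((2 * inner ℂ Ω ξ) • Ω - ξ) with he
  have hRξ : R ξ = (2 * inner ℂ Ω ξ) • Ω - ξ + e := by rw [he]; abel
  refine ⟨-((2 : ℂ) • U e), ?_, ?_⟩
  · rw [norm_neg, norm_smul, U.norm_map]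
    rw [hξn] at hR
    have : ‖(2 : ℂ)‖ = 2 := by simp
    rw [this]; linarith
  -- `R` meets only `Ω`, which it fixes exactly, and `ξ`; so accuracy at the single vector `ξ`
  -- suffices, and the error is proportional to `‖ξ‖`, the current amplitude.
  · have h1 : U.symm (S (U Ω)) = Ω - (2 : ℂ) • ξ := by
      rw [hS, map_sub, map_smul, U.symm_apply_apply]
    rw [h1, map_sub, map_smul, hRΩ, hRξ, hin]
    simp only [map_sub, map_add, map_smul, hUξ]
    push_cast
    module

end Amplification

/-! ### Real recursions for the marked amplitude and for the drift away from the uniform state. -/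

section Recursion

/-- The factor `2 - 2⁻ⁱ` makes the induction close: it grows fast enough to absorb the summable
relative errors `2⁻ⁱ/12`. -/
theorem amplitude_le {s : ℕ → ℝ} {σ : ℝ} {T : ℕ} (hσ : 0 ≤ σ) (h0 : s 0 = σ)
    (hup : ∀ i < T, s (i + 1) ≤ s i * (3 + 4 * ((1 / 2) ^ i / 16))) {i : ℕ} (hi : i ≤ T) :
    s i ≤ 3 ^ i * σ * (2 - (1 / 2) ^ i) := by
  induction i with
  | zero => rw [h0]; norm_num
  | succ i ih =>
    have h := ih (by omega)
    have hb : (0 : ℝ) < (1 / 2) ^ i := by positivity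
    have hb1 : ((1 : ℝ) / 2) ^ i ≤ 1 := pow_le_one₀ (by norm_num) (by norm_num)
    refine (hup i (by omega)).trans ((mul_le_mul_of_nonneg_right h (by positivity)).trans ?_)
    rw [pow_succ, pow_succ]
    have hx : 0 ≤ 3 ^ i * σ := by positivity
    set b := ((1 : ℝ) / 2) ^ i
    have : (2 - b) * (3 + 4 * (b / 16)) ≤ 3 * (2 - b * (1 / 2)) := by nlinarith
    calc 3 ^ i * σ * (2 - b) * (3 + 4 * (b / 16))
        = 3 ^ i * σ * ((2 - b) * (3 + 4 * (b / 16))) := by ring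
      _ ≤ 3 ^ i * σ * (3 * (2 - b * (1 / 2))) := mul_le_mul_of_nonneg_left this hx
      _ = _ := by ring

theorem amplitude_le_two {s : ℕ → ℝ} {σ : ℝ} {T : ℕ} (hσ : 0 ≤ σ) (h0 : s 0 = σ)
    (hup : ∀ i < T, s (i + 1) ≤ s i * (3 + 4 * ((1 / 2) ^ i / 16))) {i : ℕ} (hi : i ≤ T) :
    s i ≤ 2 * 3 ^ i * σ := by
  refine (amplitude_le hσ h0 hup hi).trans ?_
  have hb : (0 : ℝ) < (1 / 2) ^ i := by positivity
  have hx : 0 ≤ 3 ^ i * σ := by positivity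
  nlinarith

/-- With `x = 3^i σ`, the loss `4s²` is at most `16x²` by `amplitude_le_two`. The coefficient `2/3`
solves `27c = 3c + 16`, and the term `(1 - 2⁻ⁱ)/6` collects the reflection errors exactly; the
remaining cross term has the favourable sign. At `x = 1` the bracket is still at least `1/6`. -/
theorem le_amplitude {s : ℕ → ℝ} {σ : ℝ} {T : ℕ} (hσ : 0 ≤ σ) (h0 : s 0 = σ)
    (hs : ∀ i, 0 ≤ s i)
    (hup : ∀ i < T, s (i + 1) ≤ s i * (3 + 4 * ((1 / 2) ^ i / 16)))
    (hlow : ∀ i < T, s i * (3 - 4 * s i ^ 2 - 4 * ((1 / 2) ^ i / 16)) ≤ s (i + 1))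
    {i : ℕ} (hi : i ≤ T) (h1 : 3 ^ i * σ ≤ 1) :
    3 ^ i * σ * (1 - 2 / 3 * (3 ^ i * σ) ^ 2 - (1 - (1 / 2) ^ i) / 6) ≤ s i := by
  induction i with
  | zero => rw [h0]; simp; nlinarith [mul_nonneg hσ (sq_nonneg σ)]
  | succ i ih =>
    have hx : 0 ≤ 3 ^ i * σ := by positivity
    have hx3 : 3 * (3 ^ i * σ) ≤ 1 := by rw [pow_succ] at h1; linarith
    have h := ih (by omega) (by linarith)
    have hsu := amplitude_le_two hσ h0 hup (show i ≤ T by omega)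
    have hb : (0 : ℝ) < (1 / 2) ^ i := by positivity
    have hb1 : ((1 : ℝ) / 2) ^ i ≤ 1 := pow_le_one₀ (by norm_num) (by norm_num)
    refine le_trans ?_ (hlow i (by omega))
    have e1 : (3 : ℝ) ^ (i + 1) * σ = 3 * (3 ^ i * σ) := by rw [pow_succ]; ring
    rw [e1, pow_succ]
    have hsx : s i ≤ 2 * (3 ^ i * σ) := by linarith
    set b := ((1 : ℝ) / 2) ^ i
    set x := 3 ^ i * σ
    have hs2 : s i ^ 2 ≤ 4 * x ^ 2 := by nlinarith [hs i]
    have hx2 : x ^ 2 ≤ 1 / 9 := by nlinarith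
    have hf : 3 - 16 * x ^ 2 - b / 4 ≤ 3 - 4 * s i ^ 2 - 4 * (b / 16) := by linarith
    have hf0 : 0 ≤ 3 - 16 * x ^ 2 - b / 4 := by nlinarith
    refine le_trans ?_ (mul_le_mul h hf hf0 (hs i))
    have ha : 1 - 2 / 3 * x ^ 2 - (1 - b) / 6 ≤ 1 := by nlinarith [sq_nonneg x]
    have hy : 0 ≤ 16 / 3 * x ^ 2 + b / 12 := by positivity
    have : 3 * (1 - 2 / 3 * (3 * x) ^ 2 - (1 - b * (1 / 2)) / 6)
        ≤ (1 - 2 / 3 * x ^ 2 - (1 - b) / 6) * (3 - 16 * x ^ 2 - b / 4) := by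
      nlinarith [mul_nonneg (sub_nonneg.2 ha) hy]
    calc _ = x * (3 * (1 - 2 / 3 * (3 * x) ^ 2 - (1 - b * (1 / 2)) / 6)) := by ring
      _ ≤ x * ((1 - 2 / 3 * x ^ 2 - (1 - b) / 6) * (3 - 16 * x ^ 2 - b / 4)) :=
        mul_le_mul_of_nonneg_left this hx
      _ = _ := by ring

theorem sixth_le_amplitude {s : ℕ → ℝ} {σ : ℝ} {T : ℕ} (hσ : 0 ≤ σ) (h0 : s 0 = σ)
    (hs : ∀ i, 0 ≤ s i)
    (hup : ∀ i < T, s (i + 1) ≤ s i * (3 + 4 * ((1 / 2) ^ i / 16)))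
    (hlow : ∀ i < T, s i * (3 - 4 * s i ^ 2 - 4 * ((1 / 2) ^ i / 16)) ≤ s (i + 1))
    {i : ℕ} (hi : i ≤ T) (h1 : 3 ^ i * σ ≤ 1) :
    3 ^ i * σ / 6 ≤ s i := by
  refine le_trans ?_ (le_amplitude hσ h0 hs hup hlow hi h1)
  have hx : 0 ≤ 3 ^ i * σ := by positivity
  have hb : (0 : ℝ) < (1 / 2) ^ i := by positivity
  have : (1 : ℝ) / 6 ≤ 1 - 2 / 3 * (3 ^ i * σ) ^ 2 - (1 - (1 / 2) ^ i) / 6 := by nlinarith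
  nlinarith

/-- The increments are at most `25/4 · 2 · 3^i σ`, so the drift is a geometric sum dominated by its
last term. -/
theorem drift_le {s d : ℕ → ℝ} {σ : ℝ} {T : ℕ} (hσ : 0 ≤ σ) (h0 : s 0 = σ) (hd0 : d 0 = 0)
    (hup : ∀ i < T, s (i + 1) ≤ s i * (3 + 4 * ((1 / 2) ^ i / 16)))
    (hd : ∀ i < T, d (i + 1) ≤ d i + 25 / 4 * s i) {i : ℕ} (hi : i ≤ T) :
    d i ≤ 25 / 4 * 3 ^ i * σ := by
  induction i with
  | zero => rw [hd0]; positivity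
  | succ i ih =>
    have hsu := amplitude_le_two hσ h0 hup (show i ≤ T by omega)
    have := hd i (by omega)
    have := ih (by omega)
    rw [pow_succ]; linarith

end Recursion

/-! ### Spectral analysis of the averaged walk. -/

section Spectral

open Matrix

theorem exp_mulVec_of_mulVec_eq_smul {n : Type*} [Fintype n] [DecidableEq n] {A : Matrix n n ℂ}
    {w : n → ℂ} {z : ℂ} (h : A *ᵥ w = z • w) : NormedSpace.exp A *ᵥ w = Complex.exp z • w := by
  let _ : NormedRing (Matrix n n ℂ) := Matrix.linftyOpNormedRing
  let _ : NormedAlgebra ℂ (Matrix n n ℂ) := Matrix.linftyOpNormedAlgebra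
  have hpow : ∀ k : ℕ, A ^ k *ᵥ w = z ^ k • w := by
    intro k
    induction k with
    | zero => simp
    | succ k ih => rw [pow_succ, ← mulVec_mulVec, h, mulVec_smul, ih, smul_smul, pow_succ, mul_comm]
  have h1 := NormedSpace.exp_series_hasSum_exp' (𝕂 := ℂ) A
  have h2 : HasSum (fun k : ℕ => ((k.factorial : ℂ)⁻¹ • A ^ k) *ᵥ w) (NormedSpace.exp A *ᵥ w) := by
    have hc : Continuous (fun B : Matrix n n ℂ => B *ᵥ w) :=
      Continuous.matrix_mulVec continuous_id continuous_const
    exact h1.map (⟨⟨fun B : Matrix n n ℂ => B *ᵥ w, by simp⟩, fun B C => add_mulVec B C w⟩ :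
      Matrix n n ℂ →+ (n → ℂ)) hc
  have h3 := NormedSpace.exp_series_hasSum_exp' (𝕂 := ℂ) z
  rw [← Complex.exp_eq_exp_ℂ] at h3
  have h4 := h3.smul_const w
  refine h2.unique ?_
  convert h4 using 2 with k
  rw [smul_mulVec, hpow, smul_assoc]

variable {V : Type*} [Fintype V] [DecidableEq V] (G : SimpleGraph V) [DecidableRel G.Adj]

theorem ctqw_zero : ctqw G 0 = 1 := by
  simp [ctqw]

theorem ctqw_add (s t : ℝ) : ctqw G (s + t) = ctqw G s * ctqw G t := by
  unfold ctqw
  rw [← Matrix.exp_add_of_commute, ← add_smul]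
  · push_cast; ring_nf
  · exact ((Commute.refl _).smul_left _).smul_right _

theorem conjTranspose_ctqw (t : ℝ) : (ctqw G t)ᴴ = ctqw G (-t) := by
  unfold ctqw
  rw [← Matrix.exp_conjTranspose, conjTranspose_smul, (G.isHermitian_lapMatrix (R := ℂ)).eq]
  simp

variable {G}

theorem ctqw_mulVec {w : V → ℂ} {μ : ℝ} (h : G.lapMatrix ℂ *ᵥ w = (μ : ℂ) • w) (t : ℝ) :
    ctqw G t *ᵥ w = Complex.exp (Complex.I * (t * μ : ℝ)) • w := by
  apply exp_mulVec_of_mulVec_eq_smul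
  rw [smul_mulVec, h, smul_smul]
  push_cast; ring_nf

theorem star_dotProduct_ctqw_mulVec {w : V → ℂ} {μ : ℝ}
    (h : G.lapMatrix ℂ *ᵥ w = (μ : ℂ) • w) (t : ℝ) (η : V → ℂ) :
    star w ⬝ᵥ (ctqw G t *ᵥ η) = Complex.exp (Complex.I * (t * μ : ℝ)) * (star w ⬝ᵥ η) := by
  have h1 : star w ᵥ* ctqw G t = star (ctqw G (-t) *ᵥ w) := by
    rw [star_mulVec, conjTranspose_ctqw, neg_neg]
  rw [dotProduct_mulVec, h1, ctqw_mulVec h, star_smul, smul_dotProduct, smul_eq_mul]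
  congr 1
  rw [Complex.star_def, ← Complex.exp_conj]
  simp

variable (G)

/-- The product of the operators `(1 + e^{iLt}) / 2` over the list of the times `t`. -/
def averagedWalk (ts : List ℝ) : Matrix V V ℂ :=
  (ts.map fun t => (1 / 2 : ℂ) • (1 + ctqw G t)).reverse.prod

theorem averagedWalk_cons (t : ℝ) (ts : List ℝ) :
    averagedWalk G (t :: ts) = averagedWalk G ts * ((1 / 2 : ℂ) • (1 + ctqw G t)) := by
  simp [averagedWalk]

variable {G}

theorem star_dotProduct_averagedWalk_mulVec {w : V → ℂ} {μ : ℝ}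
    (h : G.lapMatrix ℂ *ᵥ w = (μ : ℂ) • w) (ts : List ℝ) (η : V → ℂ) :
    star w ⬝ᵥ (averagedWalk G ts *ᵥ η) =
      (ts.map fun t : ℝ => (1 + Complex.exp (Complex.I * (t * μ : ℝ))) / 2).prod *
        (star w ⬝ᵥ η) := by
  induction ts generalizing η with
  | nil => simp [averagedWalk]
  | cons t ts ih =>
    rw [averagedWalk_cons, ← mulVec_mulVec, ih, smul_mulVec, add_mulVec, one_mulVec,
      dotProduct_smul, dotProduct_add, star_dotProduct_ctqw_mulVec h, List.map_cons,
      List.prod_cons, smul_eq_mul]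
    ring

/-- Repeated use of `(1 - w)(1 + w) = 1 - w²`. The product is thus the mean of the first `2^k`
powers of `z`, obtained with only `k` factors. -/
theorem prod_one_add_pow_two_pow (z : ℂ) (k : ℕ) :
    ((List.range k).map fun j => (1 + z ^ 2 ^ j) / 2).prod * (2 ^ k * (1 - z)) = 1 - z ^ 2 ^ k := by
  induction k with
  | zero => simp
  | succ k ih =>
    rw [List.range_succ, List.map_append, List.prod_append]
    simp only [List.map_cons, List.map_nil, List.prod_cons, List.prod_nil, mul_one]
    have : (1 : ℂ) - z ^ 2 ^ (k + 1) = (1 - z ^ 2 ^ k) * (1 + z ^ 2 ^ k) := by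
      rw [pow_succ, pow_mul]; ring
    rw [this, ← ih, pow_succ]; ring

theorem norm_prod_one_add_exp_le {μ t : ℝ} {k : ℕ} (h0 : 0 < t * μ) (h1 : t * μ ≤ Real.pi) :
    ‖(((List.range k).map fun j : ℕ => t * 2 ^ j).map
      fun t : ℝ => (1 + Complex.exp (Complex.I * (t * μ : ℝ))) / 2).prod‖
      ≤ Real.pi / (t * μ * 2 ^ k) := by
  set z := Complex.exp (Complex.I * (t * μ : ℝ)) with hz
  have hmap : (((List.range k).map fun j : ℕ => t * 2 ^ j).map
      fun t : ℝ => (1 + Complex.exp (Complex.I * (t * μ : ℝ))) / 2) =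
      (List.range k).map fun j => (1 + z ^ 2 ^ j) / 2 := by
    rw [List.map_map]
    refine List.map_congr_left fun j _ => ?_
    simp only [Function.comp, hz]
    rw [← Complex.exp_nat_mul]
    congr 3
    push_cast; ring
  rw [hmap]
  have hzn : ‖z‖ = 1 := by rw [hz, mul_comm]; exact Complex.norm_exp_ofReal_mul_I _
  have key := congrArg norm (prod_one_add_pow_two_pow z k)
  rw [norm_mul, norm_mul, norm_pow] at key
  have h2 : ‖(1 : ℂ) - z ^ 2 ^ k‖ ≤ 2 := by
    refine (norm_sub_le _ _).trans ?_
    rw [norm_pow, hzn]; norm_num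
  -- Jordan's inequality for `|1 - z| = 2 sin(tμ/2)`. It requires `tμ ≤ π`, which is why the base
  -- time must be small against the largest eigenvalue.
  have h3 : 2 / Real.pi * (t * μ) ≤ ‖1 - z‖ := by
    rw [norm_sub_rev, hz, Complex.norm_exp_I_mul_ofReal_sub_one, norm_mul, Real.norm_eq_abs,
      Real.norm_eq_abs]
    have := Real.mul_le_sin (x := t * μ / 2) (by linarith) (by linarith)
    have h4 := le_abs_self (Real.sin (t * μ / 2))
    have : |(2 : ℝ)| = 2 := by norm_num
    rw [this]; linarith
  have hpi := Real.pi_pos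
  rw [le_div_iff₀ (by positivity)]
  rw [show ‖(2 : ℂ)‖ = 2 by simp] at key
  set N := ‖((List.range k).map fun j => (1 + z ^ 2 ^ j) / 2).prod‖
  have h5 : N * (2 ^ k * (2 / Real.pi * (t * μ))) ≤ 2 := by
    refine le_trans ?_ h2
    rw [← key]
    gcongr
  have h6 : N * (t * μ * 2 ^ k) = Real.pi / 2 * (N * (2 ^ k * (2 / Real.pi * (t * μ)))) := by
    field_simp
  rw [h6]; nlinarith

theorem re_im_lapMatrix_mulVec {w : V → ℂ} {μ : ℝ} (h : G.lapMatrix ℂ *ᵥ w = (μ : ℂ) • w) :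
    G.lapMatrix ℝ *ᵥ (fun v => (w v).re) = μ • (fun v => (w v).re) ∧
      G.lapMatrix ℝ *ᵥ (fun v => (w v).im) = μ • (fun v => (w v).im) := by
  constructor
  · ext v
    have := congrArg Complex.re (congrFun h v)
    rw [SimpleGraph.lapMatrix_mulVec_apply] at this ⊢
    simpa using this
  · ext v
    have := congrArg Complex.im (congrFun h v)
    rw [SimpleGraph.lapMatrix_mulVec_apply] at this ⊢
    simpa using this

/-- The gap is defined over `ℝ`, the walk lives over `ℂ`: the real or the imaginary part of a
complex eigenvector is a real eigenvector for the same real eigenvalue. -/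
theorem IsLaplacianGap.le {lam μ : ℝ} (hlam : IsLaplacianGap G lam) {w : V → ℂ} (hw : w ≠ 0)
    (h : G.lapMatrix ℂ *ᵥ w = (μ : ℂ) • w) (hμ : μ ≠ 0) : lam ≤ μ := by
  obtain ⟨hre, him⟩ := re_im_lapMatrix_mulVec h
  refine hlam.2 ⟨hμ, ?_⟩
  by_cases hz : (fun v => (w v).re) = 0
  · refine Module.End.hasEigenvalue_of_hasEigenvector (x := fun v => (w v).im)
      ⟨Module.End.mem_eigenspace_iff.2 (by rw [toLin'_apply, him]), ?_⟩
    intro hi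
    apply hw
    ext v
    exact Complex.ext (congrFun hz v) (congrFun hi v)
  · exact Module.End.hasEigenvalue_of_hasEigenvector (x := fun v => (w v).re)
      ⟨Module.End.mem_eigenspace_iff.2 (by rw [toLin'_apply, hre]), hz⟩

theorem IsLaplacianGap.pos {lam : ℝ} (hlam : IsLaplacianGap G lam) : 0 < lam := by
  obtain ⟨h0, hev⟩ := hlam.1
  obtain ⟨x, hx, hx0⟩ := hev.exists_hasEigenvector
  rw [Module.End.mem_eigenspace_iff, toLin'_apply] at hx
  have hp := (G.posSemidef_lapMatrix ℝ).dotProduct_mulVec_nonneg x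
  rw [hx, dotProduct_smul, smul_eq_mul] at hp
  have hxx : 0 < star x ⬝ᵥ x := by
    rw [star_trivial]
    exact lt_of_le_of_ne (Finset.sum_nonneg fun i _ => mul_self_nonneg _)
      (Ne.symm (by rwa [Ne, dotProduct_self_eq_zero]))
  exact lt_of_le_of_ne (by nlinarith) (Ne.symm h0)

theorem eq_of_lapMatrix_mulVec_eq_zero (hG : G.Connected) {w : V → ℂ}
    (h : G.lapMatrix ℂ *ᵥ w = 0) (u v : V) : w u = w v := by
  obtain ⟨hre, him⟩ := re_im_lapMatrix_mulVec (μ := 0) (by rw [h]; simp)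
  rw [zero_smul, SimpleGraph.lapMatrix_mulVec_eq_zero_iff_forall_reachable] at hre him
  exact Complex.ext (hre u v (hG.preconnected u v)) (him u v (hG.preconnected u v))

theorem lapMatrix_complex_mulVec_const (c : ℂ) : G.lapMatrix ℂ *ᵥ (fun _ => c) = 0 := by
  ext v
  rw [SimpleGraph.lapMatrix_mulVec_apply]
  simp

theorem ctqw_mulVec_const (c : ℂ) (t : ℝ) : ctqw G t *ᵥ (fun _ => c) = fun _ => c := by
  rw [ctqw_mulVec (μ := 0) (by rw [lapMatrix_complex_mulVec_const]; simp)]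
  simp

/-- The uniform superposition of the vertices. -/
def uniformVector (V : Type*) [Fintype V] : V → ℂ :=
  fun _ => ((Real.sqrt (Fintype.card V) : ℝ) : ℂ)⁻¹

theorem star_uniformVector_dotProduct_self (V : Type*) [Fintype V] [Nonempty V] :
    star (uniformVector V) ⬝ᵥ uniformVector V = 1 := by
  have h : (0 : ℝ) < Fintype.card V := by exact_mod_cast Fintype.card_pos
  simp only [dotProduct, uniformVector, Pi.star_apply, Finset.sum_const, Finset.card_univ,
    nsmul_eq_mul]
  rw [Complex.star_def, map_inv₀, Complex.conj_ofReal, ← mul_inv, ← Complex.ofReal_mul,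
    Real.mul_self_sqrt h.le]
  push_cast
  rw [mul_inv_cancel₀]
  exact_mod_cast h.ne'

/-- On a connected graph the averaged walk is close to the projection onto the uniform
superposition. -/
theorem norm_averagedWalk_sub_le (hG : G.Connected) {lam t B β : ℝ} {k : ℕ}
    (hlam : IsLaplacianGap G lam)
    (hB : ∀ (μ : ℝ) (w : V → ℂ), w ≠ 0 → G.lapMatrix ℂ *ᵥ w = (μ : ℂ) • w → μ ≤ B)
    (ht : 0 < t) (htB : t * B ≤ Real.pi) (hβ : 0 ≤ β) (hk : Real.pi ≤ β * (t * lam * 2 ^ k))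
    (η : V → ℂ) :
    ‖WithLp.toLp 2 (averagedWalk G ((List.range k).map fun j : ℕ => t * 2 ^ j) *ᵥ η -
      (star (uniformVector V) ⬝ᵥ η) • uniformVector V)‖ ≤ β * ‖WithLp.toLp 2 η‖ := by
  have := hG.nonempty
  have hA := G.isHermitian_lapMatrix (R := ℂ)
  set b := hA.eigenvectorBasis
  have hlp := hlam.pos
  have hinner : ∀ (i : V) (x : V → ℂ), inner ℂ (b i) (WithLp.toLp 2 x) = star (⇑(b i)) ⬝ᵥ x := by
    intro i x
    rw [EuclideanSpace.inner_eq_star_dotProduct, dotProduct_comm]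
  have hcoord : ∀ i, ‖inner ℂ (b i) (WithLp.toLp 2
      (averagedWalk G ((List.range k).map fun j : ℕ => t * 2 ^ j) *ᵥ η -
        (star (uniformVector V) ⬝ᵥ η) • uniformVector V))‖ ≤
      β * ‖inner ℂ (b i) (WithLp.toLp 2 η)‖ := by
    intro i
    have hi : G.lapMatrix ℂ *ᵥ ⇑(b i) = ((hA.eigenvalues i : ℝ) : ℂ) • ⇑(b i) := by
      have := hA.mulVec_eigenvectorBasis i
      rw [this]; rfl
    have hne : (⇑(b i) : V → ℂ) ≠ 0 := by
      intro h0
      apply b.orthonormal.ne_zero i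
      ext v; exact congrFun h0 v
    rw [hinner, hinner, dotProduct_sub, star_dotProduct_averagedWalk_mulVec hi, dotProduct_smul,
      smul_eq_mul]
    -- In an eigenbasis of `L` both operators are diagonal. By connectedness a kernel vector is a
    -- multiple of the uniform vector, and there they agree; every other eigenvector is orthogonal
    -- to it, and there the scalar product over the times is at most `β`.
    by_cases hz : hA.eigenvalues i = 0
    · rw [hz] at hi ⊢
      have hc := eq_of_lapMatrix_mulVec_eq_zero hG (w := ⇑(b i)) (by rw [hi]; simp)
      obtain ⟨v₀⟩ := hG.nonempty
      have hcard : ((Real.sqrt (Fintype.card V) : ℝ) : ℂ) ≠ 0 := by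
        have h : (0 : ℝ) < Fintype.card V := by exact_mod_cast Fintype.card_pos
        exact_mod_cast (Real.sqrt_pos.2 h).ne'
      have hbu : (⇑(b i) : V → ℂ) =
          (b i v₀ * ((Real.sqrt (Fintype.card V) : ℝ) : ℂ)) • uniformVector V := by
        ext v
        simp only [Pi.smul_apply, uniformVector, smul_eq_mul]
        rw [mul_assoc, mul_inv_cancel₀ hcard, mul_one]
        exact hc v v₀
      have hprod : ((((List.range k).map fun j : ℕ => t * 2 ^ j).map
        fun t : ℝ => (1 + Complex.exp (Complex.I * (t * 0 : ℝ))) / 2).prod) = 1 := by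
        apply List.prod_eq_one
        simp
      rw [hprod, hbu, star_smul, smul_dotProduct, smul_dotProduct,
        star_uniformVector_dotProduct_self V]
      simp only [smul_eq_mul, mul_one, one_mul]
      rw [mul_comm (star (uniformVector V) ⬝ᵥ η), sub_self, norm_zero]
      positivity
    · have hle := hlam.le hne hi hz
      have hub := hB _ _ hne hi
      set μ := hA.eigenvalues i
      have hμ0 : 0 < μ := hlp.trans_le hle
      have hu : star (⇑(b i)) ⬝ᵥ uniformVector V = 0 := by
        have h2 : G.lapMatrix ℂ *ᵥ uniformVector V = 0 := lapMatrix_complex_mulVec_const _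
        have h3 : star (⇑(b i)) ⬝ᵥ (G.lapMatrix ℂ *ᵥ uniformVector V) =
            μ * (star (⇑(b i)) ⬝ᵥ uniformVector V) := by
          rw [dotProduct_mulVec]
          have : star (⇑(b i)) ᵥ* G.lapMatrix ℂ = star (G.lapMatrix ℂ *ᵥ ⇑(b i)) := by
            rw [star_mulVec, hA.eq]
          rw [this, hi, star_smul, smul_dotProduct]
          simp
        rw [h2, dotProduct_zero] at h3
        rcases mul_eq_zero.1 h3.symm with h | h
        · exact absurd (by exact_mod_cast h) hz
        · exact h
      rw [hu, mul_zero, sub_zero, norm_mul]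
      refine mul_le_mul_of_nonneg_right ?_ (norm_nonneg _)
      refine (norm_prod_one_add_exp_le (by positivity)
        ((mul_le_mul_of_nonneg_left hub ht.le).trans htB)).trans ?_
      rw [div_le_iff₀ (by positivity)]
      refine hk.trans ?_
      gcongr
  rw [← sq_le_sq₀ (norm_nonneg _) (by positivity), mul_pow, ← b.sum_sq_norm_inner_right,
    ← b.sum_sq_norm_inner_right, Finset.mul_sum]
  refine Finset.sum_le_sum fun i _ => ?_
  rw [← mul_pow]
  exact pow_le_pow_left₀ (norm_nonneg _) (hcoord i) 2

theorem exists_eigenvalue_bound (G : SimpleGraph V) [DecidableRel G.Adj] :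
    ∃ B : ℝ, 0 < B ∧
    ∀ (μ : ℝ) (w : V → ℂ), w ≠ 0 → G.lapMatrix ℂ *ᵥ w = (μ : ℂ) • w → μ ≤ B := by
  have hfin := Module.End.finite_hasEigenvalue (toLin' (G.lapMatrix ℂ))
  have hfin' : {μ : ℝ | Module.End.HasEigenvalue (toLin' (G.lapMatrix ℂ)) (μ : ℂ)}.Finite :=
    hfin.preimage (Complex.ofReal_injective.injOn)
  obtain ⟨B, hB⟩ := hfin'.bddAbove
  refine ⟨max B 1, by positivity, fun μ w hw h => le_max_of_le_left (hB ?_)⟩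
  exact Module.End.hasEigenvalue_of_hasEigenvector (x := w)
    ⟨Module.End.mem_eigenspace_iff.2 (by rw [toLin'_apply, h]), hw⟩

end Spectral

/-! ### Real Householder reflections, which supply the ancillary unitaries. -/

section Householder

open Matrix

variable {n : Type*} [Fintype n] [DecidableEq n]

/-- The reflection along the real vector `w`. -/
def householderMatrix (w : n → ℝ) : Matrix n n ℝ :=
  1 - (2 / (w ⬝ᵥ w)) • vecMulVec w w

theorem householderMatrix_mul_self (w : n → ℝ) :
    householderMatrix w * householderMatrix w = 1 := by
  by_cases hw : w ⬝ᵥ w = 0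
  · have : w = 0 := dotProduct_self_eq_zero.1 hw
    simp [householderMatrix, this]
  · have h1 : vecMulVec w w * vecMulVec w w = (w ⬝ᵥ w) • vecMulVec w w := by
      rw [vecMulVec_mul_vecMulVec]
      simp [vecMulVec_smul]
    have h2 : 2 / (w ⬝ᵥ w) * (2 / (w ⬝ᵥ w)) * (w ⬝ᵥ w) = 2 * (2 / (w ⬝ᵥ w)) := by
      field_simp
    rw [householderMatrix, sub_mul, mul_sub, mul_sub, one_mul, mul_one, one_mul, smul_mul_smul_comm,
      h1, smul_smul, h2]
    module

theorem transpose_householderMatrix (w : n → ℝ) :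
    (householderMatrix w)ᵀ = householderMatrix w := by
  simp [householderMatrix, transpose_vecMulVec]

theorem householderMatrix_mulVec (w x : n → ℝ) :
    householderMatrix w *ᵥ x = x - (2 / (w ⬝ᵥ w) * (w ⬝ᵥ x)) • w := by
  rw [householderMatrix, sub_mulVec, one_mulVec, smul_mulVec, vecMulVec_mulVec]
  ext i
  simp
  ring

theorem householderMatrix_sub_mulVec {u v : n → ℝ} (h : u ⬝ᵥ u = v ⬝ᵥ v) :
    householderMatrix (u - v) *ᵥ u = v := by
  rw [householderMatrix_mulVec]
  -- If `u = v`, then `2 / 0 = 0` turns the reflection into the identity, as required.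
  by_cases hw : (u - v) ⬝ᵥ (u - v) = 0
  · have : u - v = 0 := dotProduct_self_eq_zero.1 hw
    rw [this, smul_zero, sub_zero]
    exact sub_eq_zero.1 this
  · have h1 : (u - v) ⬝ᵥ (u - v) = 2 * ((u - v) ⬝ᵥ u) := by
      rw [sub_dotProduct, dotProduct_sub, dotProduct_sub, sub_dotProduct, ← h,
        dotProduct_comm u v]
      ring
    have h2 : 2 / ((u - v) ⬝ᵥ (u - v)) * ((u - v) ⬝ᵥ u) = 1 := by
      rw [div_mul_eq_mul_div, ← h1, div_self hw]
    rw [h2, one_smul, sub_sub_cancel]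

/-- The Householder reflection as a unitary matrix. -/
def householder (w : n → ℝ) : unitaryGroup n ℂ :=
  ⟨(householderMatrix w).map ((↑) : ℝ → ℂ), by
    rw [mem_unitaryGroup_iff]
    have h1 : star ((householderMatrix w).map ((↑) : ℝ → ℂ)) =
        (householderMatrix w).map ((↑) : ℝ → ℂ) := by
      conv_rhs => rw [← transpose_householderMatrix]
      ext i j
      simp [star_apply]
    have h2 := congrArg (fun A : Matrix n n ℝ => A.map (Complex.ofRealHom))
      (householderMatrix_mul_self w)
    rw [h1]
    simp only [Matrix.map_mul] at h2
    exact h2.trans (by simp)⟩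

theorem householder_mul_self (w : n → ℝ) : householder w * householder w = 1 := by
  apply Subtype.ext
  have h := congrArg (fun A : Matrix n n ℝ => A.map (Complex.ofRealHom))
    (householderMatrix_mul_self w)
  simp only [Matrix.map_mul] at h
  exact h.trans (by simp)

theorem householder_apply (w : n → ℝ) (i j : n) :
    (householder w : Matrix n n ℂ) i j = (householderMatrix w i j : ℂ) := rfl

end Householder

/-! ### Gates and circuits as isometries, and their action in coordinates. -/

section Gates

open Matrix

/-- The uniform superposition of the ancillary basis states whose first qubit (the flag) is `0`. -/
def ancilla (n : ℕ) : Qubits (n + 1) → ℝ :=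
  fun x => if x 0 then 0 else (Real.sqrt (2 ^ n))⁻¹

theorem sum_qubits_flag_false (n : ℕ) (c : ℝ) :
    ∑ x : Qubits (n + 1), (if x 0 then 0 else c) = 2 ^ n * c := by
  rw [← (Fin.consEquiv (fun _ : Fin (n + 1) => Bool)).sum_comp, Fintype.sum_prod_type]
  simp [Fin.consEquiv]

theorem ancilla_dotProduct_self (n : ℕ) : ancilla n ⬝ᵥ ancilla n = 1 := by
  have : ∀ x : Qubits (n + 1), ancilla n x * ancilla n x = if x 0 then 0 else (2 ^ n : ℝ)⁻¹ := by
    intro x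
    unfold ancilla
    split_ifs
    · simp
    · rw [← mul_inv, Real.mul_self_sqrt (by positivity)]
  simp only [dotProduct, this]
  rw [sum_qubits_flag_false]
  field_simp

/-- The unitary exchanging `|0…0⟩` and `ancilla n`. -/
def prepareAncilla (n : ℕ) : unitaryGroup (Qubits (n + 1)) ℂ :=
  householder (Pi.single (fun _ => false) 1 - ancilla n)

theorem prepareAncilla_apply (n : ℕ) (x : Qubits (n + 1)) :
    (prepareAncilla n : Matrix (Qubits (n + 1)) (Qubits (n + 1)) ℂ) x (fun _ => false) =
      (ancilla n x : ℂ) := by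
  rw [prepareAncilla, householder_apply]
  have h := householderMatrix_sub_mulVec
    (u := (Pi.single (fun _ => false) 1 : Qubits (n + 1) → ℝ)) (v := ancilla n)
    (by rw [ancilla_dotProduct_self]; simp)
  have h := congrFun h x
  rw [mulVec_single_one] at h
  rw [← h]
  rfl

/-- The elementary operations of the coherent part of the search: the reflection
`2|κ⟩⟨κ| - 1` of the ancillary register, where `κ = ancilla n`, the walk controlled by the
qubit `j`, and the phase oracle. -/
inductive Gate (n : ℕ) : Type where
  | refl : Gate n
  | walk (j : Fin (n + 1)) (t : ℝ) : Gate n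
  | phase : Gate n

variable {n : ℕ}

/-- The inverse gate. -/
def Gate.inv : Gate n → Gate n
  | refl => refl
  | walk j t => walk j (-t)
  | phase => phase

/-- The inverse circuit. -/
def circuitInv (gs : List (Gate n)) : List (Gate n) :=
  (gs.map Gate.inv).reverse

/-- A gate followed by an algorithm. -/
def Gate.prepend : Gate n → Algorithm (n + 1) → Algorithm (n + 1)
  | refl, p => .walk ⟨0, -householder (ancilla n), []⟩ p
  | walk j t, p => .walk ⟨j, 1, [(t, 1)]⟩ p
  | phase, p => .phaseOracle p

/-- A circuit followed by an algorithm. -/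
def prependCircuit (gs : List (Gate n)) (p : Algorithm (n + 1)) : Algorithm (n + 1) :=
  gs.foldr Gate.prepend p

variable {V : Type*} [Fintype V] [DecidableEq V] (G : SimpleGraph V) [DecidableRel G.Adj]
  (M : Finset V)

theorem controlledWalk_mem (j : Fin (n + 1)) (t : ℝ) :
    controlledWalk G j t ∈ unitaryGroup (Qubits (n + 1) × V) ℂ := by
  rw [mem_unitaryGroup_iff, star_eq_conjTranspose, controlledWalk, conjTranspose_add,
    conjTranspose_kronecker, conjTranspose_kronecker, conjTranspose_ctqw, conjTranspose_one,
    diagonal_conjTranspose, diagonal_conjTranspose]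
  simp only [add_mul, mul_add, ← mul_kronecker_mul, diagonal_mul_diagonal, ← ctqw_add,
    add_neg_cancel, ctqw_zero, mul_one, one_mul]
  ext ⟨x, v⟩ ⟨y, u⟩
  by_cases hx : x j <;> by_cases hxy : x = y <;> by_cases huv : v = u <;>
    simp [kroneckerMap_apply, one_apply, hxy, huv] <;> simp_all

theorem phaseMatrix_mem : diagonal (fun p : Qubits (n + 1) × V => if p.2 ∈ M then (-1 : ℂ) else 1) ∈
    unitaryGroup (Qubits (n + 1) × V) ℂ := by
  rw [mem_unitaryGroup_iff, star_eq_conjTranspose, diagonal_conjTranspose, diagonal_mul_diagonal,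
    ← diagonal_one]
  congr 1
  ext p
  by_cases h : p.2 ∈ M <;> simp [h]

theorem kronecker_one_mem (U : unitaryGroup (Qubits (n + 1)) ℂ) :
    (U : Matrix (Qubits (n + 1)) (Qubits (n + 1)) ℂ) ⊗ₖ (1 : Matrix V V ℂ) ∈
      unitaryGroup (Qubits (n + 1) × V) ℂ := by
  exact kronecker_mem_unitary U.2 (one_mem _)

/-- The unitary matrix of a gate. -/
def Gate.matrix : Gate n → unitaryGroup (Qubits (n + 1) × V) ℂ
  | refl => ⟨_, kronecker_one_mem (-householder (ancilla n))⟩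
  | walk j t => ⟨_, controlledWalk_mem G j t⟩
  | phase => ⟨_, phaseMatrix_mem M⟩

/-- The Hilbert space of the joint system. -/
abbrev Joint (n : ℕ) (V : Type*) [Fintype V] : Type _ := EuclideanSpace ℂ (Qubits (n + 1) × V)

/-- The isometry of a gate. -/
def Gate.op (g : Gate n) : Joint n V ≃ₗᵢ[ℂ] Joint n V :=
  Unitary.linearIsometryEquiv ⟨toEuclideanCLM (𝕜 := ℂ) (g.matrix G M).1,
    Unitary.map_mem (toEuclideanCLM (n := Qubits (n + 1) × V) (𝕜 := ℂ)) (g.matrix G M).2⟩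

theorem Gate.op_apply (g : Gate n) (ψ : State (n + 1) V) :
    g.op G M (WithLp.toLp 2 ψ) = WithLp.toLp 2 ((g.matrix G M).1 *ᵥ ψ) := rfl

/-- The isometry of a circuit, whose gates are applied from left to right. -/
def circuitOp (gs : List (Gate n)) : Joint n V ≃ₗᵢ[ℂ] Joint n V :=
  (gs.map (Gate.op G M)).reverse.prod

@[simp]
theorem circuitOp_nil : circuitOp G M ([] : List (Gate n)) = 1 := rfl

theorem circuitOp_append (gs hs : List (Gate n)) :
    circuitOp G M (gs ++ hs) = circuitOp G M hs * circuitOp G M gs := by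
  simp [circuitOp]

theorem circuitOp_cons (g : Gate n) (gs : List (Gate n)) :
    circuitOp G M (g :: gs) = circuitOp G M gs * g.op G M := by
  simp [circuitOp]

/-- The inner product of the ancillary register with `ancilla n`. -/
def reduce (ψ : State (n + 1) V) : V → ℂ :=
  fun v => ∑ x, (ancilla n x : ℂ) * ψ (x, v)

/-- The product state of `ancilla n` and a state of the walking space. -/
def attach (η : V → ℂ) : State (n + 1) V :=
  fun p => (ancilla n p.1 : ℂ) * η p.2

theorem kronecker_one_mulVec (A : Matrix (Qubits (n + 1)) (Qubits (n + 1)) ℂ)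
    (ψ : State (n + 1) V) (x : Qubits (n + 1)) (v : V) :
    ((A ⊗ₖ (1 : Matrix V V ℂ)) *ᵥ ψ) (x, v) = ∑ y, A x y * ψ (y, v) := by
  simp [mulVec, dotProduct, Fintype.sum_prod_type, kroneckerMap_apply, one_apply]

theorem controlledWalk_mulVec (j : Fin (n + 1)) (t : ℝ) (ψ : State (n + 1) V)
    (x : Qubits (n + 1)) (v : V) :
    (controlledWalk G j t *ᵥ ψ) (x, v) =
      if x j then (ctqw G t *ᵥ fun u => ψ (x, u)) v else ψ (x, v) := by
  by_cases h : x j <;>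
  simp [controlledWalk, mulVec, dotProduct, Fintype.sum_prod_type, kroneckerMap_apply, one_apply,
    diagonal_apply, h, Finset.sum_ite_irrel]

theorem Gate.matrix_refl_mulVec (ψ : State (n + 1) V) :
    ((Gate.refl : Gate n).matrix G M).1 *ᵥ ψ = (2 : ℂ) • attach (reduce ψ) - ψ := by
  ext ⟨x, v⟩
  change (((-(householder (ancilla n)) : unitaryGroup _ ℂ) : Matrix _ _ ℂ) ⊗ₖ
    (1 : Matrix V V ℂ) *ᵥ ψ) (x, v) = _
  rw [kronecker_one_mulVec]
  simp only [attach, reduce, Pi.sub_apply, Pi.smul_apply, smul_eq_mul, Finset.mul_sum]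
  have : ∀ y, ((-(householder (ancilla n)) : unitaryGroup _ ℂ) : Matrix _ _ ℂ) x y * ψ (y, v) =
      2 * (ancilla n x * (ancilla n y * ψ (y, v))) - if x = y then ψ (y, v) else 0 := by
    intro y
    have : ((-(householder (ancilla n)) : unitaryGroup _ ℂ) : Matrix _ _ ℂ) x y =
      -((householderMatrix (ancilla n) x y : ℝ) : ℂ) := rfl
    rw [this, householderMatrix, ancilla_dotProduct_self]
    simp only [Matrix.sub_apply, Matrix.smul_apply, vecMulVec_apply, one_apply, smul_eq_mul]
    split_ifs <;> push_cast <;> ring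
  simp only [this, Finset.sum_sub_distrib, Finset.sum_ite_eq, Finset.mem_univ, if_true]

end Gates

/-! ### Fresh control qubits and the approximate reflection through the uniform state. -/

section Fresh

open Matrix

variable {n : ℕ} {V : Type*}

/-- The state does not depend on the ancillary qubit `q`. -/
def IsFresh (q : Fin (n + 1)) (ψ : State (n + 1) V) : Prop :=
  ∀ x v b, ψ (Function.update x q b, v) = ψ (x, v)

/-- The flag, that is, the first ancillary qubit, is `0`. -/
def FlagFalse (ψ : State (n + 1) V) : Prop :=
  ∀ x v, x 0 = true → ψ (x, v) = 0

/-- The gate is not a walk controlled by the qubit `q`. -/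
def Gate.Avoids (q : Fin (n + 1)) : Gate n → Prop
  | walk j _ => j ≠ q
  | refl => True
  | phase => True

theorem Gate.avoids_inv {q : Fin (n + 1)} {g : Gate n} (h : g.Avoids q) : g.inv.Avoids q := by
  cases g <;> exact h

theorem avoids_circuitInv {q : Fin (n + 1)} {gs : List (Gate n)} (h : ∀ g ∈ gs, g.Avoids q) :
    ∀ g ∈ circuitInv gs, g.Avoids q := by
  intro g hg
  simp only [circuitInv, List.mem_reverse, List.mem_map] at hg
  obtain ⟨g', hg', rfl⟩ := hg
  exact Gate.avoids_inv (h g' hg')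

theorem ancilla_update {q : Fin (n + 1)} (hq : q ≠ 0) (x : Qubits (n + 1)) (b : Bool) :
    ancilla n (Function.update x q b) = ancilla n x := by
  simp [ancilla, Function.update_of_ne hq.symm]

/-- The state `ancilla n ⊗ |π⟩`. -/
def uniformState (n : ℕ) (V : Type*) [Fintype V] : Joint n V :=
  WithLp.toLp 2 (attach (uniformVector V))

theorem attach_smul (c : ℂ) (η : V → ℂ) : (attach (c • η) : State (n + 1) V) = c • attach η := by
  ext p; simp [attach]; ring

theorem attach_sub (η θ : V → ℂ) :
    (attach (η - θ) : State (n + 1) V) = attach η - attach θ := by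
  ext p; simp [attach]; ring

theorem sum_ancilla_mul_self : ∑ x : Qubits (n + 1), (ancilla n x : ℂ) * ancilla n x = 1 := by
  have := ancilla_dotProduct_self n
  simp only [dotProduct] at this
  exact_mod_cast congrArg ((↑) : ℝ → ℂ) this

theorem reduce_attach (η : V → ℂ) : reduce (attach η : State (n + 1) V) = η := by
  ext v
  simp only [reduce, attach, ← mul_assoc, ← Finset.sum_mul, sum_ancilla_mul_self, one_mul]

theorem norm_attach [Fintype V] (η : V → ℂ) :
    ‖WithLp.toLp 2 (attach η : State (n + 1) V)‖ = ‖WithLp.toLp 2 η‖ := by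
  rw [← sq_eq_sq₀ (norm_nonneg _) (norm_nonneg _), EuclideanSpace.norm_sq_eq,
    EuclideanSpace.norm_sq_eq, Fintype.sum_prod_type]
  have : ∀ x : Qubits (n + 1), ∑ v, ‖(WithLp.toLp 2 (attach η : State (n + 1) V)).ofLp (x, v)‖ ^ 2 =
      (ancilla n x * ancilla n x) * ∑ v, ‖(WithLp.toLp 2 η).ofLp v‖ ^ 2 := by
    intro x
    rw [Finset.mul_sum]
    refine Finset.sum_congr rfl fun v _ => ?_
    simp only [attach, norm_mul, mul_pow, Complex.norm_real, Real.norm_eq_abs, sq_abs]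
    ring
  simp only [this]
  rw [← Finset.sum_mul]
  have := ancilla_dotProduct_self n
  simp only [dotProduct] at this
  rw [this, one_mul]

theorem norm_reduce_le [Fintype V] (ψ : State (n + 1) V) :
    ‖WithLp.toLp 2 (reduce ψ)‖ ≤ ‖WithLp.toLp 2 ψ‖ := by
  rw [← sq_le_sq₀ (norm_nonneg _) (norm_nonneg _), EuclideanSpace.norm_sq_eq,
    EuclideanSpace.norm_sq_eq, Fintype.sum_prod_type_right]
  refine Finset.sum_le_sum fun v _ => ?_
  change ‖∑ x, (ancilla n x : ℂ) * ψ (x, v)‖ ^ 2 ≤ ∑ x, ‖ψ (x, v)‖ ^ 2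
  have h1 : ‖∑ x, (ancilla n x : ℂ) * ψ (x, v)‖ ≤ ∑ x, |ancilla n x| * ‖ψ (x, v)‖ := by
    refine (norm_sum_le _ _).trans (le_of_eq ?_)
    refine Finset.sum_congr rfl fun x _ => ?_
    rw [norm_mul, Complex.norm_real, Real.norm_eq_abs]
  have h2 := Finset.sum_mul_sq_le_sq_mul_sq Finset.univ (fun x => |ancilla n x|)
    (fun x => ‖ψ (x, v)‖)
  have h3 : ∑ x, |ancilla n x| ^ 2 = 1 := by
    have := ancilla_dotProduct_self n
    simp only [dotProduct] at this
    rw [← this]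
    exact Finset.sum_congr rfl fun x _ => by rw [sq_abs, sq]
  rw [h3, one_mul] at h2
  exact (pow_le_pow_left₀ (norm_nonneg _) h1 2).trans h2

theorem inner_uniformState [Fintype V] (ψ : Joint n V) :
    inner ℂ (uniformState n V) ψ = star (uniformVector V) ⬝ᵥ reduce ψ.ofLp := by
  rw [EuclideanSpace.inner_eq_star_dotProduct]
  simp only [uniformState, dotProduct, reduce, Fintype.sum_prod_type_right, attach, Pi.star_apply,
    star_mul', Complex.star_def, Complex.conj_ofReal, Finset.mul_sum]
  exact Finset.sum_congr rfl fun v _ => Finset.sum_congr rfl fun x _ => by ring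

variable [Fintype V] [DecidableEq V] (G : SimpleGraph V) [DecidableRel G.Adj]
  (M : Finset V)

theorem phase_matrix_mulVec (ψ : State (n + 1) V) (x : Qubits (n + 1)) (v : V) :
    (((Gate.phase : Gate n).matrix G M).1 *ᵥ ψ) (x, v) = if v ∈ M then -ψ (x, v) else ψ (x, v) := by
  change (diagonal _ *ᵥ ψ) (x, v) = _
  rw [mulVec_diagonal]
  split_ifs <;> simp

theorem walk_matrix_mulVec (j : Fin (n + 1)) (t : ℝ) (ψ : State (n + 1) V) (x : Qubits (n + 1))
    (v : V) : (((Gate.walk j t : Gate n).matrix G M).1 *ᵥ ψ) (x, v) =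
      if x j then (ctqw G t *ᵥ fun u => ψ (x, u)) v else ψ (x, v) :=
  controlledWalk_mulVec G j t ψ x v

variable {G M}

/-- The reflection also acts on the qubit `q`, but `κ` is unchanged when `q` is flipped; hence only
a walk controlled by `q` itself can spoil freshness. -/
theorem IsFresh.gate {q : Fin (n + 1)} (hq : q ≠ 0) {ψ : State (n + 1) V} (h : IsFresh q ψ)
    {g : Gate n} (hg : g.Avoids q) : IsFresh q ((g.matrix G M).1 *ᵥ ψ) := by
  intro x v b
  cases g with
  | refl =>
    rw [Gate.matrix_refl_mulVec]
    simp only [attach, Pi.sub_apply, Pi.smul_apply, ancilla_update hq, h x v b]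
  | walk j t =>
    rw [walk_matrix_mulVec, walk_matrix_mulVec, Function.update_of_ne hg, h x v b]
    simp only [h x _ b]
  | phase => rw [phase_matrix_mulVec, phase_matrix_mulVec, h x v b]

theorem FlagFalse.gate {ψ : State (n + 1) V} (h : FlagFalse ψ) (g : Gate n) :
    FlagFalse ((g.matrix G M).1 *ᵥ ψ) := by
  intro x v hx
  cases g with
  | refl =>
    rw [Gate.matrix_refl_mulVec]
    simp [attach, ancilla, hx, h x v hx]
  | walk j t =>
    rw [walk_matrix_mulVec, h x v hx]
    have : (fun u => ψ (x, u)) = 0 := by ext u; exact h x u hx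
    rw [this, mulVec_zero]; simp
  | phase => rw [phase_matrix_mulVec, h x v hx]; simp

theorem IsFresh.circuit {q : Fin (n + 1)} (hq : q ≠ 0) {ψ : Joint n V} (h : IsFresh q ψ.ofLp)
    {gs : List (Gate n)} (hgs : ∀ g ∈ gs, g.Avoids q) :
    IsFresh q (circuitOp G M gs ψ).ofLp := by
  induction gs generalizing ψ with
  | nil => exact h
  | cons g gs ih =>
    rw [circuitOp_cons]
    exact ih (ψ := g.op G M ψ) (h.gate hq (hgs g (by simp))) fun g' hg' => hgs g' (by simp [hg'])

theorem FlagFalse.circuit {ψ : Joint n V} (h : FlagFalse ψ.ofLp) (gs : List (Gate n)) :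
    FlagFalse (circuitOp G M gs ψ).ofLp := by
  induction gs generalizing ψ with
  | nil => exact h
  | cons g gs ih =>
    rw [circuitOp_cons]
    exact ih (ψ := g.op G M ψ) (h.gate g)

variable (G M)

theorem Gate.inv_op_mul_op (g : Gate n) : g.inv.op G M * g.op G M = 1 := by
  have key : (g.inv.matrix G M).1 * (g.matrix G M).1 = 1 := by
    cases g with
    | refl =>
      change ((-householder (ancilla n) : unitaryGroup (Qubits (n + 1)) ℂ) :
        Matrix (Qubits (n + 1)) (Qubits (n + 1)) ℂ) ⊗ₖ (1 : Matrix V V ℂ) *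
        ((-householder (ancilla n) : unitaryGroup (Qubits (n + 1)) ℂ) :
          Matrix (Qubits (n + 1)) (Qubits (n + 1)) ℂ) ⊗ₖ (1 : Matrix V V ℂ) = 1
      rw [← mul_kronecker_mul, ← Submonoid.coe_mul, neg_mul_neg, householder_mul_self, one_mul,
        Submonoid.coe_one, one_kronecker_one]
    | walk j t =>
      have h := mem_unitaryGroup_iff'.1 (controlledWalk_mem G j t)
      have h2 : star (controlledWalk G j t) = controlledWalk G j (-t) := by
        rw [star_eq_conjTranspose, controlledWalk, conjTranspose_add,
          conjTranspose_kronecker, conjTranspose_kronecker, conjTranspose_ctqw, conjTranspose_one,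
          diagonal_conjTranspose, diagonal_conjTranspose, controlledWalk]
        congr 3 <;> ext x <;> simp [apply_ite]
      rw [h2] at h
      exact h
    | phase =>
      change diagonal _ * diagonal _ = 1
      rw [diagonal_mul_diagonal, ← diagonal_one]
      congr 1
      ext p
      by_cases h : p.2 ∈ M <;> simp [h]
  ext1 ψ
  change WithLp.toLp 2 ((g.inv.matrix G M).1 *ᵥ ((g.matrix G M).1 *ᵥ ψ.ofLp)) = ψ
  rw [mulVec_mulVec, key, one_mulVec]

theorem circuitOp_circuitInv (gs : List (Gate n)) :
    circuitOp G M (circuitInv gs) = (circuitOp G M gs)⁻¹ := by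
  rw [eq_inv_iff_mul_eq_one]
  induction gs with
  | nil => simp [circuitInv]
  | cons g gs ih =>
    have h : circuitInv (g :: gs) = circuitInv gs ++ [g.inv] := by simp [circuitInv]
    rw [h, circuitOp_append, circuitOp_cons, circuitOp_cons, circuitOp_nil, one_mul, mul_assoc,
      ← mul_assoc (circuitOp G M (circuitInv gs)), ih, one_mul, Gate.inv_op_mul_op]

variable {G M}

/-- A fresh qubit is in the state `|+⟩`: half of the amplitude walks, half stays. No product form `κ
⊗ η` is needed, which matters because the reflection is applied to entangled states. -/
theorem reduce_walk {q : Fin (n + 1)} (hq : q ≠ 0) {ψ : State (n + 1) V} (h : IsFresh q ψ)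
    (t : ℝ) : reduce (((Gate.walk q t : Gate n).matrix G M).1 *ᵥ ψ) =
      ((1 / 2 : ℂ) • (1 + ctqw G t)) *ᵥ reduce ψ := by
  have hred : ctqw G t *ᵥ reduce ψ =
      fun v => ∑ x, (ancilla n x : ℂ) * (ctqw G t *ᵥ fun u => ψ (x, u)) v := by
    ext v
    simp only [mulVec, dotProduct, reduce, Finset.mul_sum]
    rw [Finset.sum_comm]
    exact Finset.sum_congr rfl fun v _ => Finset.sum_congr rfl fun x _ => by ring
  ext v
  rw [smul_mulVec, add_mulVec, one_mulVec, hred]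
  simp only [reduce, walk_matrix_mulVec, Pi.smul_apply, Pi.add_apply, smul_eq_mul]
  rw [← Finset.sum_add_distrib]
  have hinv : Function.Involutive
      (fun x : Qubits (n + 1) => Function.update x q (!x q)) := by
    intro x; simp
  set f : Qubits (n + 1) → ℂ := fun x => (ancilla n x : ℂ) *
    (if x q then (ctqw G t *ᵥ fun u => ψ (x, u)) v else ψ (x, v)) with hf
  have hsum : ∑ x, f (Function.update x q (!x q)) = ∑ x, f x :=
    Equiv.sum_comp (hinv.toPerm _) f
  -- Pairing each `x` with its flip at `q` puts one walking and one resting term in every pair.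
  have : ∑ x, f x = 1 / 2 * ∑ x, (f x + f (Function.update x q (!x q))) := by
    rw [Finset.sum_add_distrib, hsum]; ring
  rw [this]
  congr 1
  refine Finset.sum_congr rfl fun x _ => ?_
  simp only [hf, ancilla_update hq, Function.update_self, h x]
  cases x q
  · simp
  · simp; ring

/-- Distinctness of the controls keeps the qubits of the remaining walks fresh, so `reduce_walk` can
be iterated. -/
theorem reduce_circuitOp_walks {l : List (Fin (n + 1) × ℝ)} (hl : (l.map Prod.fst).Nodup)
    {ψ : Joint n V} (h0 : ∀ p ∈ l, p.1 ≠ 0) (h : ∀ p ∈ l, IsFresh p.1 ψ.ofLp) :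
    reduce (circuitOp G M (l.map fun p => Gate.walk p.1 p.2) ψ).ofLp =
      averagedWalk G (l.map Prod.snd) *ᵥ reduce ψ.ofLp := by
  induction l generalizing ψ with
  | nil => simp [averagedWalk]
  | cons p l ih =>
    simp only [List.map_cons, List.nodup_cons] at hl ⊢
    rw [circuitOp_cons, averagedWalk_cons, ← mulVec_mulVec,
      ← reduce_walk (M := M) (h0 p (by simp)) (h p (by simp)) p.2]
    refine ih hl.2 (ψ := (Gate.walk p.1 p.2).op G M ψ) (fun p' hp' => h0 p' (by simp [hp'])) ?_
    intro p' hp'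
    refine (h p' (by simp [hp'])).gate (h0 p' (by simp [hp'])) ?_
    intro heq
    exact hl.1 (List.mem_map.2 ⟨p', hp', heq.symm⟩)

theorem circuitOp_walks_uniformState (l : List (Fin (n + 1) × ℝ)) :
    circuitOp G M (l.map fun p => Gate.walk p.1 p.2) (uniformState n V) = uniformState n V := by
  induction l with
  | nil => simp
  | cons p l ih =>
    rw [List.map_cons, circuitOp_cons, LinearIsometryEquiv.coe_mul, Function.comp_apply]
    convert ih using 2
    rw [uniformState, Gate.op_apply]
    congr 1
    ext ⟨x, v⟩
    rw [walk_matrix_mulVec]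
    split_ifs
    · exact congrFun (ctqw_mulVec_const (G := G)
        ((ancilla n x : ℂ) * ((Real.sqrt (Fintype.card V) : ℝ) : ℂ)⁻¹) p.2) v
    · rfl

/-- The circuit `Λ⁻¹ (2|κ⟩⟨κ| - 1) Λ`, where `Λ` consists of the walks of the list. -/
def reflectionCircuit (l : List (Fin (n + 1) × ℝ)) : List (Gate n) :=
  l.map (fun p => Gate.walk p.1 p.2) ++ Gate.refl :: circuitInv (l.map fun p => Gate.walk p.1 p.2)

theorem circuitOp_reflectionCircuit_apply (l : List (Fin (n + 1) × ℝ)) (ψ : Joint n V) :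
    circuitOp G M (reflectionCircuit l) ψ =
      (2 : ℂ) • (circuitOp G M (l.map fun p => Gate.walk p.1 p.2)).symm (WithLp.toLp 2
        (attach (reduce (circuitOp G M (l.map fun p => Gate.walk p.1 p.2) ψ).ofLp))) - ψ := by
  rw [reflectionCircuit, circuitOp_append, circuitOp_cons, circuitOp_circuitInv]
  set Λ := circuitOp G M (l.map fun p => Gate.walk p.1 p.2)
  change Λ.symm (Gate.refl.op G M (WithLp.toLp 2 (Λ ψ).ofLp)) = _
  rw [Gate.op_apply, Gate.matrix_refl_mulVec]
  have : WithLp.toLp 2 ((2 : ℂ) • attach (reduce (Λ ψ).ofLp) - (Λ ψ).ofLp) =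
    (2 : ℂ) • WithLp.toLp 2 (attach (reduce (Λ ψ).ofLp)) - Λ ψ := rfl
  rw [this, map_sub, map_smul, Λ.symm_apply_apply]

theorem circuitOp_reflectionCircuit_uniformState (l : List (Fin (n + 1) × ℝ)) :
    circuitOp G M (reflectionCircuit l) (uniformState n V) = uniformState n V := by
  have h := circuitOp_walks_uniformState (G := G) (M := M) (n := n) l
  rw [circuitOp_reflectionCircuit_apply, h]
  have : WithLp.toLp 2 (attach (reduce (uniformState n V).ofLp)) = uniformState n V := by
    rw [uniformState, reduce_attach]
  rw [this, (LinearIsometryEquiv.symm_apply_eq _).2 h.symm]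
  module

/-- The reflection circuit approximates the reflection through the uniform state. -/
theorem norm_reflectionCircuit_sub_le {l : List (Fin (n + 1) × ℝ)} (hl : (l.map Prod.fst).Nodup)
    {ψ : Joint n V} (h0 : ∀ p ∈ l, p.1 ≠ 0) (h : ∀ p ∈ l, IsFresh p.1 ψ.ofLp) {β : ℝ}
    (hβ0 : 0 ≤ β)
    (hβ : ∀ η : V → ℂ, ‖WithLp.toLp 2 (averagedWalk G (l.map Prod.snd) *ᵥ η -
      (star (uniformVector V) ⬝ᵥ η) • uniformVector V)‖ ≤ β * ‖WithLp.toLp 2 η‖) :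
    ‖circuitOp G M (reflectionCircuit l) ψ -
      ((2 * inner ℂ (uniformState n V) ψ) • uniformState n V - ψ)‖ ≤ 2 * β * ‖ψ‖ := by
  have hΩ := circuitOp_walks_uniformState (G := G) (M := M) (n := n) l
  rw [circuitOp_reflectionCircuit_apply, reduce_circuitOp_walks hl h0 h, inner_uniformState]
  set Λ := circuitOp G M (l.map fun p => Gate.walk p.1 p.2)
  set η := reduce ψ.ofLp
  have e1 : (2 : ℂ) • Λ.symm (WithLp.toLp 2 (attach (averagedWalk G (l.map Prod.snd) *ᵥ η))) - ψ -
      ((2 * star (uniformVector V) ⬝ᵥ η) • uniformState n V - ψ) =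
      (2 : ℂ) • Λ.symm (WithLp.toLp 2 (attach (averagedWalk G (l.map Prod.snd) *ᵥ η -
        (star (uniformVector V) ⬝ᵥ η) • uniformVector V))) := by
    have e2 : WithLp.toLp 2 (attach (averagedWalk G (l.map Prod.snd) *ᵥ η -
        (star (uniformVector V) ⬝ᵥ η) • uniformVector V)) =
        WithLp.toLp 2 (attach (averagedWalk G (l.map Prod.snd) *ᵥ η)) -
        (star (uniformVector V) ⬝ᵥ η) • uniformState n V := by
      rw [attach_sub, attach_smul]; rfl
    rw [e2, map_sub, map_smul, (LinearIsometryEquiv.symm_apply_eq _).2 hΩ.symm]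
    module
  rw [e1, norm_smul, LinearIsometryEquiv.norm_map, norm_attach]
  have : ‖(2 : ℂ)‖ = 2 := by simp
  rw [this, mul_assoc]
  refine mul_le_mul_of_nonneg_left ((hβ η).trans ?_) (by norm_num)
  exact mul_le_mul_of_nonneg_left (norm_reduce_le _) hβ0

end Fresh

/-! ### The recursive circuits, their costs, and repeated tries with a markedness test. -/

section Search

open Matrix

variable {n : ℕ}

/-- The recursive amplitude amplification circuits, the reflection of level `i` using the walks
of the list `l i`. -/
def searchCircuit (l : ℕ → List (Fin (n + 1) × ℝ)) : ℕ → List (Gate n)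
  | 0 => []
  | i + 1 => searchCircuit l i ++ (Gate.phase :: (circuitInv (searchCircuit l i) ++
      (reflectionCircuit (l i) ++ searchCircuit l i)))

/-- The number of queries of a gate. -/
def Gate.queries : Gate n → ℕ
  | refl => 0
  | walk _ _ => 0
  | phase => 1

/-- The evolution time of a gate. -/
def Gate.time : Gate n → ℝ
  | refl => 0
  | walk _ t => |t|
  | phase => 0

/-- The number of queries of a circuit. -/
def circuitQueries (gs : List (Gate n)) : ℕ := (gs.map Gate.queries).sum

/-- The evolution time of a circuit. -/
def circuitTime (gs : List (Gate n)) : ℝ := (gs.map Gate.time).sum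

theorem circuitQueries_append (gs hs : List (Gate n)) :
    circuitQueries (gs ++ hs) = circuitQueries gs + circuitQueries hs := by
  simp [circuitQueries]

theorem circuitQueries_cons (g : Gate n) (gs : List (Gate n)) :
    circuitQueries (g :: gs) = g.queries + circuitQueries gs := by
  simp [circuitQueries]

theorem circuitTime_append (gs hs : List (Gate n)) :
    circuitTime (gs ++ hs) = circuitTime gs + circuitTime hs := by
  simp [circuitTime]

theorem circuitTime_cons (g : Gate n) (gs : List (Gate n)) :
    circuitTime (g :: gs) = g.time + circuitTime gs := by
  simp [circuitTime]

theorem circuitQueries_circuitInv (gs : List (Gate n)) :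
    circuitQueries (circuitInv gs) = circuitQueries gs := by
  have : ∀ g : Gate n, g.inv.queries = g.queries := by intro g; cases g <;> rfl
  simp [circuitQueries, circuitInv, List.sum_reverse, Function.comp_def, this]

theorem circuitTime_circuitInv (gs : List (Gate n)) :
    circuitTime (circuitInv gs) = circuitTime gs := by
  have : ∀ g : Gate n, g.inv.time = g.time := by
    intro g; cases g <;> simp [Gate.inv, Gate.time]
  simp [circuitTime, circuitInv, List.sum_reverse, Function.comp_def, this]

theorem circuitTime_nonneg (gs : List (Gate n)) : 0 ≤ circuitTime gs := by
  refine List.sum_nonneg ?_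
  intro x hx
  obtain ⟨g, -, rfl⟩ := List.mem_map.1 hx
  cases g <;> simp [Gate.time]

theorem circuitQueries_reflectionCircuit (l : List (Fin (n + 1) × ℝ)) :
    circuitQueries (reflectionCircuit l) = 0 := by
  rw [reflectionCircuit, circuitQueries_append, circuitQueries_cons, circuitQueries_circuitInv]
  simp [circuitQueries, Gate.queries, Function.comp_def]

theorem circuitTime_reflectionCircuit (l : List (Fin (n + 1) × ℝ)) :
    circuitTime (reflectionCircuit l) = 2 * (l.map fun p => |p.2|).sum := by
  rw [reflectionCircuit, circuitTime_append, circuitTime_cons, circuitTime_circuitInv]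
  simp [circuitTime, Gate.time, Function.comp_def]
  ring

theorem circuitQueries_searchCircuit (l : ℕ → List (Fin (n + 1) × ℝ)) (i : ℕ) :
    2 * circuitQueries (searchCircuit l i) + 1 = 3 ^ i := by
  induction i with
  | zero => simp [searchCircuit, circuitQueries]
  | succ i ih =>
    simp only [searchCircuit, circuitQueries_append, circuitQueries_cons,
      circuitQueries_circuitInv, circuitQueries_reflectionCircuit, Gate.queries, pow_succ]
    omega

/-- `τ(3^i - 2^i)` is the solution of `T_{i+1} = 3T_i + τ2^i` with `T_0 = 0`; the cost of the
reflections is absorbed without a factor `i`. -/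
theorem circuitTime_searchCircuit_le {l : ℕ → List (Fin (n + 1) × ℝ)} {τ : ℝ}
    (h : ∀ i, 2 * ((l i).map fun p => |p.2|).sum ≤ τ * 2 ^ i) (i : ℕ) :
    circuitTime (searchCircuit l i) ≤ τ * (3 ^ i - 2 ^ i) := by
  induction i with
  | zero => simp [searchCircuit, circuitTime]
  | succ i ih =>
    simp only [searchCircuit, circuitTime_append, circuitTime_cons,
      circuitTime_circuitInv, circuitTime_reflectionCircuit, Gate.time, pow_succ]
    linarith [h i]

theorem avoids_reflectionCircuit {q : Fin (n + 1)} {l : List (Fin (n + 1) × ℝ)}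
    (h : ∀ p ∈ l, p.1 ≠ q) : ∀ g ∈ reflectionCircuit l, g.Avoids q := by
  have h1 : ∀ g ∈ (l.map fun p => (Gate.walk p.1 p.2 : Gate n)), g.Avoids q := by
    intro g hg
    obtain ⟨p, hp, rfl⟩ := List.mem_map.1 hg
    exact h p hp
  intro g hg
  simp only [reflectionCircuit, List.mem_append, List.mem_cons] at hg
  rcases hg with hg | rfl | hg
  · exact h1 g hg
  · trivial
  · exact avoids_circuitInv h1 g hg

theorem avoids_searchCircuit {q : Fin (n + 1)} {l : ℕ → List (Fin (n + 1) × ℝ)} {i : ℕ}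
    (h : ∀ j < i, ∀ p ∈ l j, p.1 ≠ q) : ∀ g ∈ searchCircuit l i, g.Avoids q := by
  induction i with
  | zero => simp [searchCircuit]
  | succ i ih =>
    have h1 := ih fun j hj => h j (by omega)
    intro g hg
    simp only [searchCircuit, List.mem_append, List.mem_cons] at hg
    rcases hg with hg | rfl | hg | hg | hg
    · exact h1 g hg
    · trivial
    · exact avoids_circuitInv h1 g hg
    · exact avoids_reflectionCircuit (h i (by omega)) g hg
    · exact h1 g hg

variable {V : Type*} [Fintype V] [DecidableEq V] (G : SimpleGraph V) [DecidableRel G.Adj]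
  (M : Finset V)

/-- The projection onto the marked vertices. -/
def markedProj (n : ℕ) (M : Finset V) : Joint n V →ₗ[ℂ] Joint n V where
  toFun x := WithLp.toLp 2 fun p => if p.2 ∈ M then x p else 0
  map_add' x y := by ext p; by_cases h : p.2 ∈ M <;> simp [h]
  map_smul' c x := by ext p; by_cases h : p.2 ∈ M <;> simp [h]

theorem markedProj_apply (x : Joint n V) (p : Qubits (n + 1) × V) :
    markedProj n M x p = if p.2 ∈ M then x p else 0 := rfl

variable {M} in
theorem inner_markedProj (x : Joint n V) :
    inner ℂ x (markedProj n M x) = (‖markedProj n M x‖ : ℂ) ^ 2 := by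
  have h : inner ℂ x (markedProj n M x) = inner ℂ (markedProj n M x) (markedProj n M x) := by
    rw [PiLp.inner_apply, PiLp.inner_apply]
    refine Finset.sum_congr rfl fun p _ => ?_
    rw [markedProj_apply]
    split_ifs <;> simp
  rw [h, inner_self_eq_norm_sq_to_K]
  rfl

theorem norm_markedProj_sq (x : Joint n V) :
    ‖markedProj n M x‖ ^ 2 = ∑ v ∈ M, ∑ a, ‖x (a, v)‖ ^ 2 := by
  rw [EuclideanSpace.norm_sq_eq, Fintype.sum_prod_type_right, ← Finset.sum_filter_add_sum_filter_not
    Finset.univ (· ∈ M)]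
  have h1 : ∑ v with v ∉ M, ∑ a, ‖markedProj n M x (a, v)‖ ^ 2 = 0 := by
    refine Finset.sum_eq_zero fun v hv => Finset.sum_eq_zero fun a _ => ?_
    rw [markedProj_apply]
    simp [(Finset.mem_filter.1 hv).2]
  rw [h1, add_zero]
  have : Finset.univ.filter (· ∈ M) = M := by ext; simp
  rw [this]
  refine Finset.sum_congr rfl fun v hv => Finset.sum_congr rfl fun a _ => ?_
  rw [markedProj_apply, if_pos hv]

theorem norm_markedProj_le (x : Joint n V) : ‖markedProj n M x‖ ≤ ‖x‖ := by
  rw [← sq_le_sq₀ (norm_nonneg _) (norm_nonneg _), EuclideanSpace.norm_sq_eq,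
    EuclideanSpace.norm_sq_eq]
  refine Finset.sum_le_sum fun p _ => ?_
  rw [markedProj_apply]
  split_ifs <;> simp

theorem norm_sub_markedProj_le (x : Joint n V) : ‖x - markedProj n M x‖ ≤ ‖x‖ := by
  rw [← sq_le_sq₀ (norm_nonneg _) (norm_nonneg _), EuclideanSpace.norm_sq_eq,
    EuclideanSpace.norm_sq_eq]
  refine Finset.sum_le_sum fun p _ => ?_
  rw [PiLp.sub_apply, markedProj_apply]
  split_ifs <;> simp

theorem phase_op_apply (x : Joint n V) :
    (Gate.phase : Gate n).op G M x = x - (2 : ℂ) • markedProj n M x := by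
  ext ⟨a, v⟩
  rw [PiLp.sub_apply, PiLp.smul_apply, markedProj_apply]
  refine (phase_matrix_mulVec G M x.ofLp a v).trans ?_
  split_ifs <;> simp
  ring

theorem circuitOp_searchCircuit_succ (l : ℕ → List (Fin (n + 1) × ℝ)) (i : ℕ) (x : Joint n V) :
    circuitOp G M (searchCircuit l (i + 1)) x =
      circuitOp G M (searchCircuit l i) (circuitOp G M (reflectionCircuit (l i))
        ((circuitOp G M (searchCircuit l i)).symm
          ((Gate.phase : Gate n).op G M (circuitOp G M (searchCircuit l i) x)))) := by
  simp only [searchCircuit, circuitOp_append, circuitOp_cons, circuitOp_circuitInv]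
  rfl

/-- The probability that the algorithm, run from `ψ`, outputs a marked vertex. -/
def successFrom {a : ℕ} (p : Algorithm a) (ψ : State a V) : ℝ :=
  ∑ v ∈ M, p.outputProb G M v ψ

theorem outputProb_nonneg {a : ℕ} (v : V) (p : Algorithm a) (ψ : State a V) :
    0 ≤ p.outputProb G M v ψ := by
  induction p generalizing ψ with
  | output => exact Finset.sum_nonneg fun _ _ => by positivity
  | walk W p ih => exact ih _
  | phaseOracle p ih => exact ih _
  | oracle j p ih => exact ih _
  | measure j p₀ p₁ h₀ h₁ => exact add_nonneg (h₀ _) (h₁ _)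

theorem successFrom_nonneg {a : ℕ} (p : Algorithm a) (ψ : State a V) :
    0 ≤ successFrom G M p ψ :=
  Finset.sum_nonneg fun v _ => outputProb_nonneg G M v p ψ

theorem outputProb_prepend (g : Gate n) (p : Algorithm (n + 1)) (ψ : State (n + 1) V) (v : V) :
    (g.prepend p).outputProb G M v ψ = p.outputProb G M v ((g.matrix G M).1 *ᵥ ψ) := by
  cases g with
  | refl => rfl
  | walk j t =>
    change p.outputProb G M v (CIQW.op G _ *ᵥ ψ) = _
    congr 2
    simp only [CIQW.op, List.foldl_cons, List.foldl_nil, OneMemClass.coe_one, one_kronecker_one,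
      one_mul, mul_one]
    rfl
  | phase =>
    change p.outputProb G M v (applyPhaseOracle M ψ) = _
    congr 1
    ext ⟨x, u⟩
    rw [phase_matrix_mulVec]
    rfl

theorem successFrom_prependCircuit (gs : List (Gate n)) (p : Algorithm (n + 1)) (ψ : Joint n V) :
    successFrom G M (prependCircuit gs p) ψ.ofLp =
      successFrom G M p (circuitOp G M gs ψ).ofLp := by
  induction gs generalizing ψ with
  | nil => rfl
  | cons g gs ih =>
    rw [circuitOp_cons]
    refine Eq.trans ?_ (ih (g.op G M ψ))
    exact Finset.sum_congr rfl fun v _ => outputProb_prepend G M g _ _ v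

/-- Applies a circuit, then checks whether the vertex is marked, then outputs it or goes on. -/
def attempt (gs : List (Gate n)) (p : Algorithm (n + 1)) : Algorithm (n + 1) :=
  prependCircuit gs (.oracle 0 (.measure 0 p .output))

/-- With the flag at `0`, the standard oracle writes markedness into it, so measuring the flag is
the projective measurement `{P, 1 - P}`. The unmarked branch has flag `0` again, and can enter the
next try. -/
theorem successFrom_attempt (gs : List (Gate n)) (p : Algorithm (n + 1)) {ψ : Joint n V}
    (hψ : FlagFalse ψ.ofLp) :
    successFrom G M (attempt gs p) ψ.ofLp =
      successFrom G M p (circuitOp G M gs ψ - markedProj n M (circuitOp G M gs ψ)).ofLp +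
        ‖markedProj n M (circuitOp G M gs ψ)‖ ^ 2 := by
  rw [attempt, successFrom_prependCircuit]
  have hφ : FlagFalse (circuitOp G M gs ψ).ofLp := hψ.circuit gs
  set φ := circuitOp G M gs ψ
  have h0 : projectQubit 0 false (applyOracle M 0 φ.ofLp) = (φ - markedProj n M φ).ofLp := by
    ext ⟨x, v⟩
    change (if x 0 = false then φ.ofLp (if v ∈ M then Function.update x 0 (!x 0) else x, v) else 0)
      = φ.ofLp (x, v) - markedProj n M φ (x, v)
    rw [markedProj_apply]
    by_cases hv : v ∈ M <;> cases hx : x 0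
    · simp only [hv, if_true, sub_self, Bool.not_false]
      exact hφ _ _ (by simp)
    · simp [hv]
    · simp [hv]
    · simp [hv, hφ x v hx]
  have h1 : ∀ v ∈ M, ∑ x, ‖projectQubit 0 true (applyOracle M 0 φ.ofLp) (x, v)‖ ^ 2 =
      ∑ x, ‖φ (x, v)‖ ^ 2 := by
    intro v hv
    have hinv : Function.Involutive
        (fun x : Qubits (n + 1) => Function.update x 0 (!x 0)) := by
      intro x; simp
    rw [← Equiv.sum_comp (hinv.toPerm _)]
    refine Finset.sum_congr rfl fun x _ => ?_
    change ‖if (Function.update x 0 (!x 0)) 0 = true then φ.ofLp (if v ∈ M then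
      Function.update (Function.update x 0 (!x 0)) 0 (!(Function.update x 0 (!x 0)) 0)
      else Function.update x 0 (!x 0), v) else 0‖ ^ 2 = ‖φ.ofLp (x, v)‖ ^ 2
    cases hx : x 0
    · have e := Function.update_eq_self 0 x
      rw [hx] at e
      simp [hv, e]
    · simp [hφ x v hx]
  rw [norm_markedProj_sq, ← h0, ← Finset.sum_congr rfl h1, successFrom, successFrom,
    ← Finset.sum_add_distrib]
  rfl

/-- Successive attempts with the circuits `C k`, …, `C (k + m - 1)`. -/
def attempts (C : ℕ → List (Gate n)) : ℕ → ℕ → Algorithm (n + 1)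
  | 0, _ => .output
  | m + 1, k => attempt (C k) (attempts C m (k + 1))

theorem FlagFalse.sub_markedProj {ψ : Joint n V} (hψ : FlagFalse ψ.ofLp) :
    FlagFalse (ψ - markedProj n M ψ).ofLp := by
  intro x v hx
  change ψ.ofLp (x, v) - markedProj n M ψ (x, v) = 0
  rw [markedProj_apply, hψ x v hx]
  simp

/-- Only the try with index `k + i` is counted; the others serve to control its input. All maps are
isometries or contractions, so the distance of the leftover state from `Ω` grows at each try by at
most the deviation which that circuit produces on `Ω` itself. Thus later tries may reuse qubits:
freshness matters only for circuits run on `Ω`. -/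
theorem sq_le_successFrom_attempts (C : ℕ → List (Gate n)) (Ω : Joint n V) {y : ℝ} (hy : 0 ≤ y)
    (i m k : ℕ) (him : i < m) (ψ : Joint n V) (hψ : FlagFalse ψ.ofLp)
    (h : y + ‖ψ - Ω‖ + ∑ j ∈ Finset.range i, ‖circuitOp G M (C (k + j)) Ω -
      markedProj n M (circuitOp G M (C (k + j)) Ω) - Ω‖ ≤
        ‖markedProj n M (circuitOp G M (C (k + i)) Ω)‖) :
    y ^ 2 ≤ successFrom G M (attempts C m k) ψ.ofLp := by
  induction i generalizing m k ψ with
  | zero =>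
    obtain ⟨m, rfl⟩ : ∃ m', m = m' + 1 := ⟨m - 1, by omega⟩
    rw [attempts, successFrom_attempt G M _ _ hψ]
    refine le_add_of_nonneg_of_le (successFrom_nonneg _ _ _ _) (pow_le_pow_left₀ hy ?_ 2)
    simp only [Finset.range_zero, Finset.sum_empty, add_zero] at h
    have h1 : ‖markedProj n M (circuitOp G M (C k) Ω)‖ ≤
        ‖markedProj n M (circuitOp G M (C k) ψ)‖ + ‖ψ - Ω‖ := by
      have h2 : markedProj n M (circuitOp G M (C k) Ω) = markedProj n M (circuitOp G M (C k) ψ) -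
          markedProj n M (circuitOp G M (C k) (ψ - Ω)) := by
        rw [map_sub, map_sub, sub_sub_cancel]
      rw [h2]
      refine (norm_sub_le _ _).trans (add_le_add_right ?_ _)
      exact (norm_markedProj_le M _).trans (LinearIsometryEquiv.norm_map _ _).le
    linarith
  | succ i ih =>
    obtain ⟨m, rfl⟩ : ∃ m', m = m' + 1 := ⟨m - 1, by omega⟩
    rw [attempts, successFrom_attempt G M _ _ hψ]
    refine le_add_of_le_of_nonneg (ih m (k + 1) (by omega) _
      (FlagFalse.sub_markedProj M (hψ.circuit _)) ?_) (by positivity)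
    rw [Finset.sum_range_succ'] at h
    have hidx : ∀ j, k + 1 + j = k + (j + 1) := fun j => by ring
    simp only [hidx]
    rw [add_zero] at h
    refine le_trans ?_ h
    have h3 : circuitOp G M (C k) ψ - markedProj n M (circuitOp G M (C k) ψ) - Ω =
        (circuitOp G M (C k) (ψ - Ω) - markedProj n M (circuitOp G M (C k) (ψ - Ω))) +
        (circuitOp G M (C k) Ω - markedProj n M (circuitOp G M (C k) Ω) - Ω) := by
      rw [map_sub, map_sub]; abel
    have h4 : ‖circuitOp G M (C k) ψ - markedProj n M (circuitOp G M (C k) ψ) - Ω‖ ≤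
        ‖ψ - Ω‖ + ‖circuitOp G M (C k) Ω - markedProj n M (circuitOp G M (C k) Ω) - Ω‖ := by
      rw [h3]
      refine (norm_add_le _ _).trans (add_le_add_left ?_ _)
      exact (norm_sub_markedProj_le M _).trans (LinearIsometryEquiv.norm_map _ _).le
    linarith

theorem queries_prependCircuit (gs : List (Gate n)) (p : Algorithm (n + 1)) :
    (prependCircuit gs p).queries = circuitQueries gs + p.queries := by
  induction gs with
  | nil => simp [prependCircuit, circuitQueries]
  | cons g gs ih =>
    rw [circuitQueries_cons, add_assoc, ← ih]
    cases g
    · exact (zero_add _).symm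
    · exact (zero_add _).symm
    · exact add_comm _ _

theorem time_prependCircuit (gs : List (Gate n)) (p : Algorithm (n + 1)) :
    (prependCircuit gs p).time = circuitTime gs + p.time := by
  induction gs with
  | nil => simp [prependCircuit, circuitTime]
  | cons g gs ih =>
    rw [circuitTime_cons, add_assoc, ← ih]
    cases g <;> simp [prependCircuit, Gate.prepend, Algorithm.time, CIQW.time, Gate.time]

theorem queries_attempts (C : ℕ → List (Gate n)) (m k : ℕ) :
    (attempts C m k).queries = ∑ j ∈ Finset.range m, (circuitQueries (C (k + j)) + 1) := by
  induction m generalizing k with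
  | zero => rfl
  | succ m ih =>
    rw [attempts, attempt, queries_prependCircuit, Algorithm.queries, Algorithm.queries, ih,
      Finset.sum_range_succ', Algorithm.queries, max_eq_left (Nat.zero_le _)]
    have hidx : ∀ j, k + 1 + j = k + (j + 1) := fun j => by ring
    simp only [hidx, add_zero]
    ring

theorem time_attempts (C : ℕ → List (Gate n)) (m k : ℕ) :
    (attempts C m k).time = ∑ j ∈ Finset.range m, circuitTime (C (k + j)) := by
  induction m generalizing k with
  | zero => rfl
  | succ m ih =>
    rw [attempts, attempt, time_prependCircuit, Algorithm.time, Algorithm.time, ih,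
      Finset.sum_range_succ', Algorithm.time,
      max_eq_left (Finset.sum_nonneg fun j _ => circuitTime_nonneg _)]
    have hidx : ∀ j, k + 1 + j = k + (j + 1) := fun j => by ring
    simp only [hidx, add_zero]
    ring

end Search

/-! ### The schedule of walk times and qubits, and the assembly of the bounds. -/

section Main

open Matrix

variable {n : ℕ} {V : Type*} [Fintype V] [DecidableEq V] (G : SimpleGraph V) [DecidableRel G.Adj]
  (M : Finset V)

theorem flagFalse_uniformState (n : ℕ) (V : Type*) [Fintype V] :
    FlagFalse (uniformState n V).ofLp := by
  intro x v hx
  simp [uniformState, attach, ancilla, hx]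

theorem isFresh_uniformState (V : Type*) [Fintype V] {q : Fin (n + 1)} (hq : q ≠ 0) :
    IsFresh q (uniformState n V).ofLp := by
  intro x v b
  simp [uniformState, attach, ancilla_update hq]

theorem norm_uniformState (n : ℕ) (V : Type*) [Fintype V] [Nonempty V] :
    ‖uniformState n V‖ = 1 := by
  rw [uniformState, norm_attach, ← sq_eq_sq₀ (norm_nonneg _) zero_le_one, one_pow,
    EuclideanSpace.norm_sq_eq]
  have h : (0 : ℝ) < Fintype.card V := by exact_mod_cast Fintype.card_pos
  simp only [uniformVector, norm_inv, Complex.norm_real, Real.norm_eq_abs, inv_pow, sq_abs,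
    Real.sq_sqrt h.le, Finset.sum_const, Finset.card_univ, nsmul_eq_mul]
  exact mul_inv_cancel₀ h.ne'

theorem norm_markedProj_uniformState_sq :
    ‖markedProj n M (uniformState n V)‖ ^ 2 = M.card / Fintype.card V := by
  rw [norm_markedProj_sq]
  have h1 : ∀ v : V, ∑ a, ‖uniformState n V (a, v)‖ ^ 2 = (Fintype.card V : ℝ)⁻¹ := by
    intro v
    have h2 : ∀ a, ‖uniformState n V (a, v)‖ ^ 2 =
        (ancilla n a * ancilla n a) * (Fintype.card V : ℝ)⁻¹ := by
      intro a
      simp only [uniformState, attach, uniformVector, norm_mul, norm_inv, Complex.norm_real,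
        Real.norm_eq_abs, mul_pow, inv_pow, sq_abs, Real.sq_sqrt (Nat.cast_nonneg (Fintype.card V))]
      rw [sq]
    simp only [h2]
    rw [← Finset.sum_mul]
    have := ancilla_dotProduct_self n
    simp only [dotProduct] at this
    rw [this, one_mul]
  simp only [h1, Finset.sum_const, nsmul_eq_mul]
  rfl

theorem markedProj_markedProj (x : Joint n V) :
    markedProj n M (markedProj n M x) = markedProj n M x := by
  ext p
  rw [markedProj_apply, markedProj_apply]
  split_ifs <;> rfl

/-- The walks of the levels below `T` act on fresh qubits, and the reflection of level `i`
has error at most `2⁻ⁱ / 8`. -/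
structure IsSchedule (T : ℕ) (l : ℕ → List (Fin (n + 1) × ℝ)) : Prop where
  nodup : ∀ i < T, ((l i).map Prod.fst).Nodup
  ne_zero : ∀ i < T, ∀ p ∈ l i, p.1 ≠ 0
  fresh : ∀ i < T, ∀ j < i, ∀ p ∈ l i, ∀ p' ∈ l j, p'.1 ≠ p.1
  error : ∀ i < T, ∀ η : V → ℂ, ‖WithLp.toLp 2 (averagedWalk G ((l i).map Prod.snd) *ᵥ η -
      (star (uniformVector V) ⬝ᵥ η) • uniformVector V)‖ ≤ ((1 / 2) ^ i / 16) * ‖WithLp.toLp 2 η‖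

variable {G}

/-- The vector to be reflected is `A_i⁻¹ P A_i Ω`. It is fresh for the qubits of level `i`, since
the circuits of the lower levels never walk under their control and `P` does not touch the ancillas.
-/
theorem IsSchedule.step {T : ℕ} {l : ℕ → List (Fin (n + 1) × ℝ)} (hl : IsSchedule G T l) {i : ℕ}
    (hi : i < T) :
    ∃ e : Joint n V, ‖e‖ ≤ 4 * ((1 / 2) ^ i / 16) *
        ‖markedProj n M (circuitOp G M (searchCircuit l i) (uniformState n V))‖ ∧
      circuitOp G M (searchCircuit l (i + 1)) (uniformState n V) =
        ((1 - 4 * ‖markedProj n M (circuitOp G M (searchCircuit l i) (uniformState n V))‖ ^ 2 : ℝ) :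
          ℂ) • circuitOp G M (searchCircuit l i) (uniformState n V) +
        (2 : ℂ) • markedProj n M (circuitOp G M (searchCircuit l i) (uniformState n V)) + e := by
  rw [circuitOp_searchCircuit_succ]
  refine exists_amplification_step _ _ _ _ _ _ inner_markedProj (phase_op_apply G M)
    (circuitOp_reflectionCircuit_uniformState _) ?_
  refine norm_reflectionCircuit_sub_le (hl.nodup i hi) (hl.ne_zero i hi) ?_ (by positivity)
    (hl.error i hi)
  intro p hp
  have hp0 := hl.ne_zero i hi p hp
  have hav := avoids_searchCircuit (l := l) (i := i) (q := p.1)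
    fun j hj p' hp' => hl.fresh i hi j hj p hp p' hp'
  have h1 := (isFresh_uniformState V hp0).circuit (G := G) (M := M) hp0 hav
  have h2 : IsFresh p.1 (markedProj n M
      (circuitOp G M (searchCircuit l i) (uniformState n V))).ofLp := by
    intro x v b
    change markedProj n M _ (_, v) = markedProj n M _ (x, v)
    rw [markedProj_apply, markedProj_apply]
    simp only [h1 x v b]
  have h3 := h2.circuit (G := G) (M := M) hp0 (avoids_circuitInv hav)
  rw [circuitOp_circuitInv] at h3
  exact h3

/-- Applying `P` to the step gives the factor `3 - 4s²`, while the step itself moves the state by at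
most `4s² + 2s + s/4 ≤ 25s/4`. Removing the marked part costs a further `s_i ≤ 2 · 3^i σ`, whence
`33/4`. -/
theorem IsSchedule.amplitude_bounds [Nonempty V] {T : ℕ} {l : ℕ → List (Fin (n + 1) × ℝ)}
    (hl : IsSchedule G T l) {i : ℕ} (hi : i ≤ T) :
    ‖circuitOp G M (searchCircuit l i) (uniformState n V) -
      markedProj n M (circuitOp G M (searchCircuit l i) (uniformState n V)) - uniformState n V‖ ≤
        33 / 4 * 3 ^ i * ‖markedProj n M (uniformState n V)‖ ∧
    (3 ^ i * ‖markedProj n M (uniformState n V)‖ ≤ 1 →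
      3 ^ i * ‖markedProj n M (uniformState n V)‖ / 6 ≤
        ‖markedProj n M (circuitOp G M (searchCircuit l i) (uniformState n V))‖) := by
  set Ω := uniformState n V with hΩ
  set φ : ℕ → Joint n V := fun i => circuitOp G M (searchCircuit l i) Ω with hφ
  set s : ℕ → ℝ := fun i => ‖markedProj n M (φ i)‖ with hs
  have hn : ∀ i, ‖φ i‖ = 1 := fun i =>
    (LinearIsometryEquiv.norm_map _ _).trans (norm_uniformState n V)
  have hs0 : ∀ i, 0 ≤ s i := fun i => norm_nonneg _
  have hs1 : ∀ i, s i ≤ 1 := fun i => (norm_markedProj_le M _).trans (hn i).le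
  have h0 : φ 0 = Ω := rfl
  have hstep : ∀ i < T, ∃ e : Joint n V, ‖e‖ ≤ 4 * ((1 / 2) ^ i / 16) * s i ∧
      φ (i + 1) = ((1 - 4 * s i ^ 2 : ℝ) : ℂ) • φ i + (2 : ℂ) • markedProj n M (φ i) + e :=
    fun i hi => hl.step M hi
  have hmark : ∀ i < T, ∃ e : Joint n V, ‖e‖ ≤ 4 * ((1 / 2) ^ i / 16) * s i ∧
      markedProj n M (φ (i + 1)) = ((3 - 4 * s i ^ 2 : ℝ) : ℂ) • markedProj n M (φ i) + e := by
    intro i hi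
    obtain ⟨e, he, h⟩ := hstep i hi
    refine ⟨markedProj n M e, (norm_markedProj_le M e).trans he, ?_⟩
    rw [h, map_add, map_add, map_smul, map_smul, markedProj_markedProj]
    push_cast
    module
  have hup : ∀ i < T, s (i + 1) ≤ s i * (3 + 4 * ((1 / 2) ^ i / 16)) := by
    intro i hi
    obtain ⟨e, he, h⟩ := hmark i hi
    have h1 : s (i + 1) ≤ |3 - 4 * s i ^ 2| * s i + ‖e‖ := by
      change ‖markedProj n M (φ (i + 1))‖ ≤ _
      rw [h]
      refine (norm_add_le _ _).trans (le_of_eq ?_)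
      rw [norm_smul, Complex.norm_real, Real.norm_eq_abs]
    have h2 : |3 - 4 * s i ^ 2| ≤ 3 := by
      rw [abs_le]; constructor <;> nlinarith [hs0 i, hs1 i]
    nlinarith [mul_le_mul_of_nonneg_right h2 (hs0 i)]
  have hlow : ∀ i < T, s i * (3 - 4 * s i ^ 2 - 4 * ((1 / 2) ^ i / 16)) ≤ s (i + 1) := by
    intro i hi
    obtain ⟨e, he, h⟩ := hmark i hi
    have h1 : |3 - 4 * s i ^ 2| * s i - ‖e‖ ≤ s (i + 1) := by
      change _ ≤ ‖markedProj n M (φ (i + 1))‖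
      rw [h]
      have := norm_sub_le_norm_add (((3 - 4 * s i ^ 2 : ℝ) : ℂ) • markedProj n M (φ i)) e
      rwa [norm_smul, Complex.norm_real, Real.norm_eq_abs] at this
    nlinarith [mul_le_mul_of_nonneg_right (le_abs_self (3 - 4 * s i ^ 2)) (hs0 i)]
  have hd : ∀ i < T, ‖φ (i + 1) - Ω‖ ≤ ‖φ i - Ω‖ + 25 / 4 * s i := by
    intro i hi
    obtain ⟨e, he, h⟩ := hstep i hi
    have hb1 : ((1 : ℝ) / 2) ^ i ≤ 1 := pow_le_one₀ (by norm_num) (by norm_num)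
    have h1 : φ (i + 1) - Ω = (φ i - Ω) + (-(4 * s i ^ 2 : ℝ) : ℂ) • φ i +
        (2 : ℂ) • markedProj n M (φ i) + e := by
      rw [h]; push_cast; module
    have h2 : ‖(-(4 * s i ^ 2 : ℝ) : ℂ) • φ i‖ = 4 * s i ^ 2 := by
      rw [norm_smul, norm_neg, Complex.norm_real, Real.norm_eq_abs, hn, mul_one,
        abs_of_nonneg (by positivity)]
    have h3 : ‖(2 : ℂ) • markedProj n M (φ i)‖ = 2 * s i := by
      rw [norm_smul]; simp [hs]
    have h4 : ‖φ (i + 1) - Ω‖ ≤ ‖φ i - Ω‖ + 4 * s i ^ 2 + 2 * s i + ‖e‖ := by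
      rw [h1]
      have n1 := norm_add_le ((φ i - Ω) + (-(4 * s i ^ 2 : ℝ) : ℂ) • φ i +
        (2 : ℂ) • markedProj n M (φ i)) e
      have n2 := norm_add_le ((φ i - Ω) + (-(4 * s i ^ 2 : ℝ) : ℂ) • φ i)
        ((2 : ℂ) • markedProj n M (φ i))
      have n3 := norm_add_le (φ i - Ω) ((-(4 * s i ^ 2 : ℝ) : ℂ) • φ i)
      linarith
    have h5 : ‖e‖ ≤ 1 / 4 * s i :=
      he.trans (mul_le_mul_of_nonneg_right (by linarith) (hs0 i))
    nlinarith [hs0 i, hs1 i]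
  have hσ : (0 : ℝ) ≤ ‖markedProj n M Ω‖ := norm_nonneg _
  have hsle := amplitude_le_two (s := s) hσ rfl hup hi
  have hdle := drift_le (s := s) (d := fun i => ‖φ i - Ω‖) hσ rfl (by simp [h0]) hup hd hi
  refine ⟨?_, fun h => sixth_le_amplitude (s := s) hσ rfl hs0 hup hlow hi h⟩
  change ‖φ i - markedProj n M (φ i) - Ω‖ ≤ _
  have : φ i - markedProj n M (φ i) - Ω = (φ i - Ω) - markedProj n M (φ i) := by abel
  rw [this]
  refine (norm_sub_le _ _).trans ?_
  change ‖φ i - Ω‖ + s i ≤ _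
  have hdle' : ‖φ i - Ω‖ ≤ 25 / 4 * 3 ^ i * ‖markedProj n M Ω‖ := hdle
  linarith

theorem sum_pow_le (K : ℕ) : ∑ j ∈ Finset.range K, (243 : ℝ) ^ j ≤ 243 ^ K / 242 := by
  rw [geom_sum_eq (by norm_num)]
  have : (0 : ℝ) < 243 ^ K := by positivity
  norm_num
  linarith

theorem IsSchedule.le_successFrom [Nonempty V] {K₁ : ℕ} {l : ℕ → List (Fin (n + 1) × ℝ)}
    (hl : IsSchedule G (5 * K₁) l) {K : ℕ} (hK : K ≤ K₁)
    (h1 : 243 ^ K * ‖markedProj n M (uniformState n V)‖ ≤ 1)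
    (h2 : 1 ≤ 243 ^ (K + 1) * ‖markedProj n M (uniformState n V)‖) :
    (1 / 2430) ^ 2 ≤ successFrom G M (attempts (fun j => searchCircuit l (5 * j)) (K₁ + 1) 0)
      (uniformState n V).ofLp := by
  set σ := ‖markedProj n M (uniformState n V)‖ with hσ
  have hσ0 : 0 ≤ σ := norm_nonneg _
  have h35 : ∀ j : ℕ, (3 : ℝ) ^ (5 * j) = 243 ^ j := fun j => by rw [pow_mul]; norm_num
  refine sq_le_successFrom_attempts G M _ (uniformState n V) (by norm_num) K (K₁ + 1) 0 (by omega)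
    _ (flagFalse_uniformState n V) ?_
  simp only [zero_add, sub_self, norm_zero, add_zero]
  have hlow := (hl.amplitude_bounds M (i := 5 * K) (by omega)).2
  rw [h35] at hlow
  refine le_trans ?_ (hlow h1)
  have hsum : ∑ j ∈ Finset.range K, ‖circuitOp G M (searchCircuit l (5 * j)) (uniformState n V) -
      markedProj n M (circuitOp G M (searchCircuit l (5 * j)) (uniformState n V)) -
        uniformState n V‖ ≤ 33 / 4 * (243 ^ K / 242) * σ := by
    calc _ ≤ ∑ j ∈ Finset.range K, 33 / 4 * 243 ^ j * σ := by
          refine Finset.sum_le_sum fun j hj => ?_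
          have := (hl.amplitude_bounds M (i := 5 * j)
            (by have := Finset.mem_range.1 hj; omega)).1
          rwa [h35] at this
      _ = 33 / 4 * (∑ j ∈ Finset.range K, 243 ^ j) * σ := by
          rw [Finset.mul_sum, Finset.sum_mul]
      _ ≤ _ := by
          gcongr
          exact sum_pow_le K
  -- The earlier deviations use up `33/968` of the `1/6` available. More than `1/10` of `243^K σ ≥
  -- 1/243` remains, hence `1/2430`. Advancing five levels at a time keeps the geometric sum this
  -- small.
  rw [pow_succ] at h2
  have : 0 ≤ 243 ^ K * σ := by positivity
  linarith

theorem prepareAncilla_mulVec_initialState (n : ℕ) (V : Type*) [Fintype V] [DecidableEq V] :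
    ((prepareAncilla n : Matrix (Qubits (n + 1)) (Qubits (n + 1)) ℂ) ⊗ₖ (1 : Matrix V V ℂ)) *ᵥ
      initialState (n + 1) V = (uniformState n V).ofLp := by
  ext ⟨x, v⟩
  rw [kronecker_one_mulVec]
  simp only [initialState, mul_ite, mul_zero, Finset.sum_ite_eq', Finset.mem_univ, if_true,
    prepareAncilla_apply]
  rfl

/-- The qubits and times of the walks of the level `i`. -/
def schedule (T k : ℕ) (lam : ℝ) (i : ℕ) : List (Fin (T * k + 1) × ℝ) :=
  (List.range k).map fun j =>
    (Fin.ofNat (T * k + 1) (i * k + j + 1), 16 * Real.pi * 2 ^ i / (lam * 2 ^ k) * 2 ^ j)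

/-- The reduction modulo `T * k + 1` in `Fin.ofNat` is harmless below level `T`; the shift by one
reserves qubit `0` for the flag. -/
theorem schedule_qubit_val {T k i j : ℕ} (hi : i < T) (hj : j < k) :
    (Fin.ofNat (T * k + 1) (i * k + j + 1)).val = i * k + j + 1 := by
  rw [Fin.val_ofNat]
  apply Nat.mod_eq_of_lt
  have : (i + 1) * k ≤ T * k := Nat.mul_le_mul_right k hi
  rw [add_mul] at this
  omega

/-- A large `k` makes the base time so short that `tB ≤ π`, while `t2^k = 16π2^i/λ` is fixed by the
wanted error. The largest eigenvalue therefore affects the number of qubits only, not the order of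
the evolution time. -/
theorem isSchedule_schedule (hG : G.Connected) {lam B : ℝ} (hlam : IsLaplacianGap G lam)
    (hB0 : 0 < B)
    (hB : ∀ (μ : ℝ) (w : V → ℂ), w ≠ 0 → G.lapMatrix ℂ *ᵥ w = (μ : ℂ) • w → μ ≤ B) {T k : ℕ}
    (hk : 16 * 2 ^ T * B / lam ≤ 2 ^ k) : IsSchedule G T (schedule T k lam) where
  nodup i hi := by
    rw [schedule, List.map_map]
    refine List.Nodup.map_on ?_ List.nodup_range
    intro j hj j' hj' h
    have := congrArg Fin.val h
    simp only [Function.comp] at this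
    rw [schedule_qubit_val hi (List.mem_range.1 hj), schedule_qubit_val hi (List.mem_range.1 hj')]
      at this
    omega
  ne_zero i hi p hp h := by
    obtain ⟨j, hj, rfl⟩ := List.mem_map.1 hp
    have := congrArg Fin.val h
    rw [schedule_qubit_val hi (List.mem_range.1 hj)] at this
    simp at this
  fresh i hi j hj p hp p' hp' h := by
    obtain ⟨b, hb, rfl⟩ := List.mem_map.1 hp
    obtain ⟨b', hb', rfl⟩ := List.mem_map.1 hp'
    have := congrArg Fin.val h
    rw [List.mem_range] at hb hb'
    rw [schedule_qubit_val hi hb, schedule_qubit_val (hj.trans hi) hb'] at this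
    have h2 : (j + 1) * k ≤ i * k := Nat.mul_le_mul_right k hj
    rw [add_mul] at h2
    omega
  error i hi η := by
    have hlp := hlam.pos
    have hpi := Real.pi_pos
    rw [schedule, List.map_map]
    refine norm_averagedWalk_sub_le hG hlam hB (by positivity) ?_ (by positivity) ?_ η
    · have h1 : (2 : ℝ) ^ i ≤ 2 ^ T := pow_le_pow_right₀ (by norm_num) hi.le
      have h2 : 16 * 2 ^ i * B / lam ≤ 2 ^ k := by
        refine le_trans ?_ hk
        gcongr
      rw [div_le_iff₀ hlp] at h2
      rw [div_mul_eq_mul_div, div_le_iff₀ (by positivity)]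
      nlinarith
    · have h2 : ((1 : ℝ) / 2) ^ i * 2 ^ i = 1 := by rw [← mul_pow]; norm_num
      have : (1 / 2) ^ i / 16 * (16 * Real.pi * 2 ^ i / (lam * 2 ^ k) * lam * 2 ^ k) =
          Real.pi * ((1 / 2) ^ i * 2 ^ i) := by
        field_simp
      rw [this, h2, mul_one]

theorem sum_map_mul_two_pow (t : ℝ) (k : ℕ) :
    ((List.range k).map fun j => t * 2 ^ j).sum = t * (2 ^ k - 1) := by
  induction k with
  | zero => simp
  | succ k ih =>
    rw [List.range_succ, List.map_append, List.sum_append, ih, pow_succ]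
    simp
    ring

theorem two_mul_sum_schedule_le (T k : ℕ) {lam : ℝ} (hlam : 0 < lam) (i : ℕ) :
    2 * ((schedule T k lam i).map fun p => |p.2|).sum ≤ 32 * Real.pi / lam * 2 ^ i := by
  have hpi := Real.pi_pos
  set t := 16 * Real.pi * 2 ^ i / (lam * 2 ^ k) with ht
  have ht0 : 0 < t := by positivity
  have hsum : ((schedule T k lam i).map fun p => |p.2|).sum = t * (2 ^ k - 1) := by
    rw [schedule, List.map_map]
    have : ∀ j : ℕ, |t * 2 ^ j| = t * 2 ^ j := fun j => abs_of_pos (by positivity)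
    simp only [Function.comp_def, ← ht, this]
    exact sum_map_mul_two_pow t k
  rw [hsum]
  have : 32 * Real.pi / lam * 2 ^ i = 2 * (t * 2 ^ k) := by
    rw [ht]; field_simp; ring
  nlinarith

end Main

end SpatialSearch

end

theorem mainTheorem3 :
    ∃ c C : ℝ, 0 < c ∧ 0 < C ∧
      ∀ (V : Type*) [Fintype V] [DecidableEq V] (G : SimpleGraph V) [DecidableRel G.Adj]
        (lam ε : ℝ), G.Connected → SpatialSearch.IsLaplacianGap G lam → 0 < ε → ε ≤ 1 →
        ∃ (a : ℕ) (A : SpatialSearch.Algorithm a),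
          (A.queries : ℝ) ≤ C / Real.sqrt ε ∧
          A.time ≤ C / (lam * Real.sqrt ε) ∧
          ∀ M : Finset V, ε * (Fintype.card V : ℝ) ≤ (M.card : ℝ) →
            c ≤ A.successProb G M := by
  refine ⟨(1 / 2430) ^ 2, 256, by norm_num, by norm_num, ?_⟩
  intro V _ _ G _ lam ε hG hlam hε0 hε1
  have := hG.nonempty
  have hlp := hlam.pos
  have hsε : 0 < Real.sqrt ε := Real.sqrt_pos.2 hε0
  have hsε1 : Real.sqrt ε ≤ 1 := Real.sqrt_le_one.2 hε1
  -- `5K₁` is the last level ever needed: since `σ ≥ √ε`, the right level `5K`, with `243^K ≤ 1/σ <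
  -- 243^(K+1)`, does not exceed it.
  obtain ⟨K₁, hK₁, hK₁'⟩ := exists_nat_pow_near (x := (Real.sqrt ε)⁻¹) (y := 243)
    ((one_le_inv₀ hsε).2 hsε1) (by norm_num)
  obtain ⟨B, hB0, hB⟩ := SpatialSearch.exists_eigenvalue_bound G
  obtain ⟨k, hk⟩ := pow_unbounded_of_one_lt (16 * 2 ^ (5 * K₁) * B / lam)
    (show (1 : ℝ) < 2 by norm_num)
  have hl := SpatialSearch.isSchedule_schedule hG hlam hB0 hB hk.le
  set l := SpatialSearch.schedule (5 * K₁) k lam with hldef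
  have h35 : ∀ j : ℕ, (3 : ℝ) ^ (5 * j) = 243 ^ j := fun j => by rw [pow_mul]; norm_num
  have hsum : ∑ j ∈ Finset.range (K₁ + 1), (243 : ℝ) ^ j ≤ 2 * (Real.sqrt ε)⁻¹ := by
    refine (SpatialSearch.sum_pow_le _).trans ?_
    rw [pow_succ]
    have : (0 : ℝ) < (Real.sqrt ε)⁻¹ := by positivity
    linarith
  refine ⟨5 * K₁ * k + 1, .walk ⟨0, SpatialSearch.prepareAncilla _, []⟩
    (SpatialSearch.attempts (fun j => SpatialSearch.searchCircuit l (5 * j)) (K₁ + 1) 0),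
    ?_, ?_, ?_⟩
  · rw [SpatialSearch.Algorithm.queries, SpatialSearch.queries_attempts]
    push_cast
    calc _ ≤ ∑ j ∈ Finset.range (K₁ + 1), (243 : ℝ) ^ j := by
          refine Finset.sum_le_sum fun j _ => ?_
          rw [zero_add]
          -- A try makes `(243^j - 1)/2` queries in its circuit and one more for the test, at most
          -- `243^j` in all.
          have h1 := SpatialSearch.circuitQueries_searchCircuit l (5 * j)
          have h2 : (2 : ℝ) * SpatialSearch.circuitQueries (SpatialSearch.searchCircuit l (5 * j)) +
            1 = 243 ^ j := by rw [← h35]; exact_mod_cast h1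
          have h3 : (1 : ℝ) ≤ 243 ^ j := one_le_pow₀ (by norm_num)
          linarith
      _ ≤ 2 * (Real.sqrt ε)⁻¹ := hsum
      _ ≤ 256 / Real.sqrt ε := by
          rw [div_eq_mul_inv]
          gcongr
          norm_num
  · rw [SpatialSearch.Algorithm.time, SpatialSearch.time_attempts]
    have h0 : SpatialSearch.CIQW.time (a := 5 * K₁ * k + 1)
        ⟨0, SpatialSearch.prepareAncilla _, []⟩ = 0 := by
      simp [SpatialSearch.CIQW.time]
    have hpi := Real.pi_pos
    have hpi4 := Real.pi_le_four
    rw [h0, zero_add]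
    calc _ ≤ ∑ j ∈ Finset.range (K₁ + 1), 32 * Real.pi / lam * (243 : ℝ) ^ j := by
          refine Finset.sum_le_sum fun j _ => ?_
          rw [zero_add]
          refine (SpatialSearch.circuitTime_searchCircuit_le
            (SpatialSearch.two_mul_sum_schedule_le _ _ hlp) (5 * j)).trans ?_
          rw [h35]
          refine mul_le_mul_of_nonneg_left ?_ (by positivity)
          have : (0 : ℝ) < 2 ^ (5 * j) := by positivity
          linarith
      _ = 32 * Real.pi / lam * ∑ j ∈ Finset.range (K₁ + 1), (243 : ℝ) ^ j := by
          rw [Finset.mul_sum]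
      _ ≤ 32 * 4 / lam * (2 * (Real.sqrt ε)⁻¹) := by gcongr
      _ = 256 / (lam * Real.sqrt ε) := by field_simp; norm_num
  · intro M hM
    have hcard : (0 : ℝ) < Fintype.card V := by exact_mod_cast Fintype.card_pos
    set σ := ‖SpatialSearch.markedProj (5 * K₁ * k) M
      (SpatialSearch.uniformState (5 * K₁ * k) V)‖ with hσ
    have hσsq : σ ^ 2 = M.card / Fintype.card V :=
      SpatialSearch.norm_markedProj_uniformState_sq M
    have hσ0 : 0 ≤ σ := norm_nonneg _
    have hσε : Real.sqrt ε ≤ σ := by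
      refine Real.sqrt_le_iff.2 ⟨hσ0, ?_⟩
      rw [hσsq, le_div_iff₀ hcard]
      exact hM
    have hσpos : 0 < σ := hsε.trans_le hσε
    have hσ1 : σ ≤ 1 := by
      refine (SpatialSearch.norm_markedProj_le M _).trans ?_
      rw [SpatialSearch.norm_uniformState]
    obtain ⟨K, hK, hK'⟩ := exists_nat_pow_near (x := σ⁻¹) (y := 243)
      ((one_le_inv₀ hσpos).2 hσ1) (by norm_num)
    have hKK : K ≤ K₁ := by
      have h1 : (243 : ℝ) ^ K < 243 ^ (K₁ + 1) :=
        (hK.trans (inv_anti₀ hsε hσε)).trans_lt hK₁'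
      have := (pow_lt_pow_iff_right₀ (by norm_num)).1 h1
      omega
    rw [← one_div, le_div_iff₀ hσpos] at hK
    rw [← one_div, div_lt_iff₀ hσpos] at hK'
    refine (hl.le_successFrom M hKK hK hK'.le).trans (le_of_eq ?_)
    rw [← SpatialSearch.prepareAncilla_mulVec_initialState]
    rfl
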